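/- **Setting.** Let $d,q\ge 0$ be integers. Let $X$ be a random vector in $\mathbb R^d$ whose law is absolutely continuous with respect to Lebesgue measure and carried by a bounded set $\mathcal X$. Let $g_0(y|x)=f_0(y|h_0(x,\eta_0),\nu_0)$ (the pre-trained model) be a fixed, known, jointly measurable conditional probability density of $Y\in\mathbb R$ given $x$, and let $f(y|m,v)$ be the Gaussian density with mean $m$ and variance $v>0$. Let $h:\mathbb R^d\times\mathbb R^q\to\mathbb R$ (the prompt expert) be measurable in $x$ for each $\eta$ and, for almost every $x$, continuously differentiable in $\eta$; assume that for every $R>0$ there is $L_R$ with $\mathbb E[L_R(X)]<\infty$ and $\|\partial h/\partial\eta(x,\eta)\|\le L_R(x)$ for almost every $x$ and all $\|\eta\|\le R$. Let $\Theta\subseteq\mathbb R^q\times(0,\infty)$ have at least two points, and let $\Xi\subset\mathbb R^d\times\mathbb R\times\mathbb R^q\times(0,\infty)$ be a compact set of parameters $G=(\beta,\tau,\eta,\nu)$ with $(\eta,\nu)\in\Theta$ for all $G\in\Xi$. "Almost every $x$" is with respect to the law of $X$, "almost every $y$" with respect to Lebesgue measure on $\mathbb R$, and "almost every $(x,y)$"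 with respect to their product. For $G\in\Xi$ put $$p_G(y|x)=\frac{1}{1+\exp(\beta^\top x+\tau)}\,f_0(y|h_0(x,\eta_0),\nu_0)+\frac{\exp(\beta^\top x+\tau)}{1+\exp(\beta^\top x+\tau)}\,f(y|h(x,\eta),\nu).$$ For densities $p,r$ on $\mathbb R$ let $d_H^2(p,r)=\frac12\int(\sqrt p-\sqrt r)^2\,dy$, and for parameters $G,G_*$ let $$D_1(G,G_*)=|e^{\tau}-e^{\tau^*}|+(e^{\tau}+e^{\tau^*})\,\|(\beta,\eta,\nu)-(\beta^*,\eta^*,\nu^*)\|$$ with the Euclidean norm. **Distinguishability.** $f_0$ is distinguishable from $f$ if, for all distinct $(\eta_1,\nu_1),(\eta_2,\nu_2)\in\Theta$ and all measurable $b_0,b_1,c_0,c_1,c_2:\mathbb R^d\to\mathbb R$, the identity $$b_0(x)f_0(y|h_0(x,\eta_0),\nu_0)+b_1(x)f(y|h(x,\eta_1),\nu_1)+c_0(x)f(y|m,\nu_2)+c_1(x)\frac{\partial f}{\partial m}(y|m,\nu_2)+c_2(x)\frac{\partial f}{\partial\nu}(y|m,\nu_2)=0,\quad m=h(x,\eta_2),$$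 for almost every $(x,y)$ implies $b_0(x)=b_1(x)=c_0(x)=c_1(x)=c_2(x)=0$ for almost every $x$. **Theorem.** Suppose that $f_0$ is distinguishable from $f$, and that the Jacobian of the prompt expert does not vanish in any direction: for every $\eta\in\mathbb R^q$ and every $a\in\mathbb R^q\setminus\{0\}$, the function $x\mapsto a^\top\frac{\partial h}{\partial\eta}(x,\eta)$ is not almost everywhere zero. Then there is a constant $C_1>0$ such that $$\mathbb E_X\big[d_H(p_G(\cdot|X),p_{G_*}(\cdot|X))\big]\ \ge\ C_1\,D_1(G,G_*)\qquad\text{for all }G,G_*\in\Xi.$$ Moreover there is a constant $C>0$ such that for every $n\ge2$, every $G_*=(\beta^*,\tau^*,\eta^*,\nu^*)\in\Xi$ and every measurable maximum likelihood estimator $\widehat G_n=(\widehat\beta_n,\widehat\tau_n,\widehat\eta_n,\widehat\nu_n)$, i.e. $\widehat G_n\in\operatorname{argmax}_{G\in\Xi}\sum_{i=1}^n\log p_G(Y_i|X_i)$ almost surely, computed from an i.i.d. sample $(X_1,Y_1),\dots,(X_n,Y_n)$ with $X_i\sim X$ and $Y_i|X_i\sim p_{G_*}(\cdot|X_i)$,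 $$\mathbb E_{p_{G_*,n}}\big[|e^{\widehat\tau_n}-e^{\tau^*}|^2\big]\le C\,\frac{\log n}{n},\qquad \mathbb E_{p_{G_*,n}}\big[e^{2\tau^*}\|(\widehat\beta_n,\widehat\eta_n,\widehat\nu_n)-(\beta^*,\eta^*,\nu^*)\|^2\big]\le C\,\frac{\log n}{n}.$$ -/

import Mathlib

open MeasureTheory ProbabilityTheory

noncomputable section

namespace ContaminatedMoE

/-- Parameters `G = (β, τ, η, ν)` of the gate and of the prompt, in `ℝ^d × ℝ × ℝ^q × ℝ`. -/
abbrev Param (d q : ℕ) : Type :=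
  EuclideanSpace ℝ (Fin d) × ℝ × EuclideanSpace ℝ (Fin q) × ℝ

/-- The gating slope `β`. -/
def Param.β {d q : ℕ} (G : Param d q) : EuclideanSpace ℝ (Fin d) := G.1

/-- The gating bias `τ`. -/
def Param.τ {d q : ℕ} (G : Param d q) : ℝ := G.2.1

/-- The parameter `η` of the prompt expert. -/
def Param.η {d q : ℕ} (G : Param d q) : EuclideanSpace ℝ (Fin q) := G.2.2.1

/-- The variance `ν` of the prompt. -/
def Param.ν {d q : ℕ} (G : Param d q) : ℝ := G.2.2.2

/-- The prompt density `f(y | m, v)`: the Gaussian density with mean `m` and variance `v > 0`. -/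
def promptDensity (m v y : ℝ) : ℝ := gaussianPDFReal m v.toNNReal y

/-- The pre-trained conditional density `(x, y) ↦ f₀(y | h₀(x, η₀), ν₀)`. -/
def pretrained {d q₀ : ℕ} (f₀ : ℝ → ℝ → ℝ → ℝ)
    (h₀ : EuclideanSpace ℝ (Fin d) → EuclideanSpace ℝ (Fin q₀) → ℝ)
    (η₀ : EuclideanSpace ℝ (Fin q₀)) (ν₀ : ℝ) : EuclideanSpace ℝ (Fin d) → ℝ → ℝ :=
  fun x y => f₀ (h₀ x η₀) ν₀ y

/-- `g` is a conditional Lebesgue density of a real response given `x ∈ ℝ^d`. -/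
structure IsConditionalDensity {d : ℕ} (g : EuclideanSpace ℝ (Fin d) → ℝ → ℝ) : Prop where
  measurable : Measurable fun z : EuclideanSpace ℝ (Fin d) × ℝ => g z.1 z.2
  nonneg : ∀ x y, 0 ≤ g x y
  integral_eq_one : ∀ x, ∫ y, g x y = 1

/-- The softmax-contaminated mixture of experts
`p_G(y | x) = f₀ / (1 + exp(βᵀx + τ)) + exp(βᵀx + τ) / (1 + exp(βᵀx + τ)) · f(y | h(x, η), ν)`,
where `g₀ x y` is the value of the pre-trained conditional density. -/
def modelDensity {d q : ℕ} (g₀ : EuclideanSpace ℝ (Fin d) → ℝ → ℝ)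
    (h : EuclideanSpace ℝ (Fin d) → EuclideanSpace ℝ (Fin q) → ℝ)
    (G : Param d q) (x : EuclideanSpace ℝ (Fin d)) (y : ℝ) : ℝ :=
  1 / (1 + Real.exp (inner ℝ G.β x + G.τ)) * g₀ x y
    + Real.exp (inner ℝ G.β x + G.τ) / (1 + Real.exp (inner ℝ G.β x + G.τ))
      * promptDensity (h x G.η) G.ν y

/-- Hellinger distance, `d_H²(p, r) = ½ ∫ (√p - √r)²`. -/
def hellinger (p r : ℝ → ℝ) : ℝ :=
  Real.sqrt (1 / 2 * ∫ y, (Real.sqrt (p y) - Real.sqrt (r y)) ^ 2)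

/-- The Euclidean norm of `(β, η, ν) - (β', η', ν')`. -/
def promptDist {d q : ℕ} (G G' : Param d q) : ℝ :=
  Real.sqrt (‖G.β - G'.β‖ ^ 2 + ‖G.η - G'.η‖ ^ 2 + (G.ν - G'.ν) ^ 2)

/-- The loss `D₁(G, G') = |exp τ - exp τ'| + (exp τ + exp τ') ‖(β, η, ν) - (β', η', ν')‖`. -/
def lossD₁ {d q : ℕ} (G G' : Param d q) : ℝ :=
  |Real.exp G.τ - Real.exp G'.τ| + (Real.exp G.τ + Real.exp G'.τ) * promptDist G G'

/-- Distinguishability of the pre-trained conditional density `g₀` from the Gaussian prompt with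
expert `h` over the set `Θ` of values of `(η, ν)`, for covariates with law `μ`.
The first derivatives of `f(y | h(x, η₂), ν₂)` enter as `∂f/∂h` (in the mean) and `∂f/∂ν`: by the
chain rule every `∂f/∂η⁽ᵘ⁾` is `∂h/∂η⁽ᵘ⁾(x, η₂)`, a function of `x` alone, times `∂f/∂h`, so for
`q ≥ 2` the `q` derivatives in `η` are always linearly dependent over functions of `x`. -/
def Distinguishable {d q : ℕ} (μ : Measure (EuclideanSpace ℝ (Fin d)))
    (g₀ : EuclideanSpace ℝ (Fin d) → ℝ → ℝ)
    (h : EuclideanSpace ℝ (Fin d) → EuclideanSpace ℝ (Fin q) → ℝ)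
    (Θ : Set (EuclideanSpace ℝ (Fin q) × ℝ)) : Prop :=
  ∀ θ₁ ∈ Θ, ∀ θ₂ ∈ Θ, θ₁ ≠ θ₂ →
    ∀ b₀ b₁ c₀ c₁ c₂ : EuclideanSpace ℝ (Fin d) → ℝ,
      Measurable b₀ → Measurable b₁ → Measurable c₀ → Measurable c₁ → Measurable c₂ →
      (∀ᵐ z ∂(μ.prod (volume : Measure ℝ)),
        b₀ z.1 * g₀ z.1 z.2
          + b₁ z.1 * promptDensity (h z.1 θ₁.1) θ₁.2 z.2
          + (c₀ z.1 * promptDensity (h z.1 θ₂.1) θ₂.2 z.2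
            + c₁ z.1 * deriv (fun m => promptDensity m θ₂.2 z.2) (h z.1 θ₂.1)
            + c₂ z.1 * deriv (fun v => promptDensity (h z.1 θ₂.1) v z.2) θ₂.2) = 0) →
      ∀ᵐ x ∂μ, b₀ x = 0 ∧ b₁ x = 0 ∧ c₀ x = 0 ∧ c₁ x = 0 ∧ c₂ x = 0

/-- The law of one pair `(X, Y)` with `X ∼ μ` and `Y | X ∼ p_G(· | X)`. -/
def pairLaw {d q : ℕ} (μ : Measure (EuclideanSpace ℝ (Fin d)))
    (g₀ : EuclideanSpace ℝ (Fin d) → ℝ → ℝ)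
    (h : EuclideanSpace ℝ (Fin d) → EuclideanSpace ℝ (Fin q) → ℝ) (G : Param d q) :
    Measure (EuclideanSpace ℝ (Fin d) × ℝ) :=
  (μ.prod (volume : Measure ℝ)).withDensity
    fun z => ENNReal.ofReal (modelDensity g₀ h G z.1 z.2)

/-- The law of an i.i.d. sample `(X₁, Y₁), …, (Xₙ, Yₙ)` from the model with parameter `G`. -/
def sampleLaw {d q : ℕ} (μ : Measure (EuclideanSpace ℝ (Fin d)))
    (g₀ : EuclideanSpace ℝ (Fin d) → ℝ → ℝ)
    (h : EuclideanSpace ℝ (Fin d) → EuclideanSpace ℝ (Fin q) → ℝ) (G : Param d q) (n : ℕ) :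
    Measure (Fin n → EuclideanSpace ℝ (Fin d) × ℝ) :=
  Measure.pi fun _ => pairLaw μ g₀ h G

/-- The conditional log-likelihood `∑ log p_G(Yᵢ | Xᵢ)` of a sample. -/
def logLikelihood {d q n : ℕ} (g₀ : EuclideanSpace ℝ (Fin d) → ℝ → ℝ)
    (h : EuclideanSpace ℝ (Fin d) → EuclideanSpace ℝ (Fin q) → ℝ)
    (s : Fin n → EuclideanSpace ℝ (Fin d) × ℝ) (G : Param d q) : ℝ :=
  ∑ i, Real.log (modelDensity g₀ h G (s i).1 (s i).2)

/-- `G` maximizes the log-likelihood of the sample `s` over the parameter space `Ξ`. -/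
def IsMLE {d q n : ℕ} (g₀ : EuclideanSpace ℝ (Fin d) → ℝ → ℝ)
    (h : EuclideanSpace ℝ (Fin d) → EuclideanSpace ℝ (Fin q) → ℝ) (Ξ : Set (Param d q))
    (s : Fin n → EuclideanSpace ℝ (Fin d) × ℝ) (G : Param d q) : Prop :=
  G ∈ Ξ ∧ ∀ G' ∈ Ξ, logLikelihood g₀ h s G' ≤ logLikelihood g₀ h s G

end ContaminatedMoE

end

/-!
Both parts rest on one inequality: over `Ξ`, the `L¹` distance of two model densities dominates the
distance of their parameters (`exists_mul_norm_sub_le_integral_abs`). Otherwise there are parameters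
`Gₙ, Gₙ'` whose densities are closer in `L¹` than `‖Gₙ - Gₙ'‖ / (n + 1)`, and by compactness they
and the directions `(Gₙ - Gₙ') / ‖Gₙ - Gₙ'‖` converge along a subsequence. Divide the difference of
the densities by `‖Gₙ - Gₙ'‖` and pass to the limit by Fatou's lemma. If the limits `G, G'` differ,
the densities of `G` and `G'` agree almost everywhere. If they coincide, strict differentiability of
the density in its parameter shows that its derivative at `G` in a direction of norm one vanishes
almost everywhere. In either case distinguishability annihilates all coefficients of the resulting
linear relation; since an affine function that vanishes almost everywhere for an absolutely
continuous law is zero, and since the Jacobian of the expert vanishes in no direction, this is a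
contradiction. The loss `D₁` is bounded by a multiple of the distance of the parameters, and the
`L¹` distance by a multiple of the mean Hellinger distance, whence the first claim.

The second claim follows from the first and from the bound `log n / n` for the squared Hellinger
risk of a maximum likelihood estimator (`exists_hellinger_risk_bound`). For every `n`, polynomially
many functions `u` of integral at most `exp (1 / n)` are such that each model density lies below one
of them (`exists_upper_brackets`). They are explicit: a Gaussian density whose mean moves by at most
`a` stays below a Gaussian density cut in two at its peak, whose halves are moved apart by `2 a`, and
this adds only a multiple of `a` to the integral. Hence integrability of the bound `L` of the
derivative of the expert is enough. If the maximum likelihood estimator selects a density below `u`,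
then `∏ √(u / p) ≥ 1` for the true density `p`, while the expectation of this product is the `n`-th
power of the affinity `∫ √(u p)`, which is at most `1 + 2 / n` minus a multiple of the squared
Hellinger distance. So the expectation of the exponential of `n` times the squared distance is at
most a constant times the number of the functions `u`, and a Jensen type inequality gives the bound
for the expectation (`lintegral_risk_le_log_card_add_exp`).
-/

noncomputable section

namespace ContaminatedMoE

open Filter Topology

/-! ### Covers of polynomial size, and the risk of estimators under an exponential bound -/

section

/-- A bounded set in a finite-dimensional space is covered at scale `1 / n` by polynomially many of
its points. In coordinates, one point is chosen in every cell of a cubic grid that meets the set. -/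
theorem exists_finset_cover_card_le_pow {E : Type*} [NormedAddCommGroup E] [NormedSpace ℝ E]
    [FiniteDimensional ℝ E] {S : Set E} (hS : Bornology.IsBounded S) :
    ∃ K k : ℕ, ∀ n : ℕ, 1 ≤ n → ∃ J : Finset E, (∀ y ∈ J, y ∈ S) ∧ J.card ≤ (K * n) ^ k ∧
      ∀ x ∈ S, ∃ y ∈ J, ‖x - y‖ ≤ 1 / (n : ℝ) := by
  classical
  set k := Module.finrank ℝ E with hk
  let e : E ≃L[ℝ] (Fin k → ℝ) := ContinuousLinearEquiv.ofFinrankEq (by simp [hk])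
  obtain ⟨R, hR⟩ := hS.exists_norm_le
  obtain ⟨M, hM⟩ := exists_nat_ge (‖(e : E →L[ℝ] (Fin k → ℝ))‖ * R)
  obtain ⟨A, hA⟩ := exists_nat_ge (‖(e.symm : (Fin k → ℝ) →L[ℝ] E)‖)
  refine ⟨2 * (M * (A + 1)) + 3, k, fun n hn => ?_⟩
  -- a grid finer by the factor `A + 1` makes up for the norm of the inverse coordinate map
  set m : ℕ := (A + 1) * n with hm
  have hm0 : 0 < m := by positivity
  let F : E → Fin k → ℤ := fun x i => ⌊(m : ℝ) * e x i⌋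
  have hco : ∀ x ∈ S, ∀ i, |e x i| ≤ M := fun x hx i => by
    calc |e x i| ≤ ‖e x‖ := norm_le_pi_norm (e x) i
      _ ≤ ‖(e : E →L[ℝ] (Fin k → ℝ))‖ * ‖x‖ := (e : E →L[ℝ] (Fin k → ℝ)).le_opNorm x
      _ ≤ ‖(e : E →L[ℝ] (Fin k → ℝ))‖ * R := by gcongr; exact hR x hx
      _ ≤ M := hM
  let T : Finset (Fin k → ℤ) :=
    Fintype.piFinset fun _ => Finset.Icc (-(m * M + 1 : ℤ)) (m * M : ℤ)
  have hFT : ∀ x ∈ S, F x ∈ T := fun x hx => by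
    refine Fintype.mem_piFinset.2 fun i => Finset.mem_Icc.2 ⟨?_, ?_⟩
    · refine Int.le_floor.2 ?_
      push_cast
      have := (abs_le.1 (hco x hx i)).1
      have : (m : ℝ) * -M ≤ m * e x i := by gcongr
      linarith
    · have := (abs_le.1 (hco x hx i)).2
      have h1 : (m : ℝ) * e x i ≤ m * M := by gcongr
      have h2 : ((⌊(m : ℝ) * e x i⌋ : ℤ) : ℝ) ≤ m * M := (Int.floor_le _).trans h1
      exact_mod_cast h2
  have hTcard : T.card = (2 * (m * M) + 2) ^ k := by
    simp only [T, Fintype.card_piFinset, Int.card_Icc, Finset.prod_const, Finset.card_univ,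
      Fintype.card_fin]
    congr 1
    omega
  let T' := T.filter fun t => ∃ x ∈ S, F x = t
  have hT' : ∀ t ∈ T', ∃ x ∈ S, F x = t := fun t ht => (Finset.mem_filter.1 ht).2
  choose! g hg using hT'
  refine ⟨T'.image g, ?_, ?_, ?_⟩
  · intro y hy
    obtain ⟨t, ht, rfl⟩ := Finset.mem_image.1 hy
    exact (hg t ht).1
  · calc (T'.image g).card ≤ T'.card := Finset.card_image_le
      _ ≤ T.card := Finset.card_filter_le _ _
      _ = (2 * (m * M) + 2) ^ k := hTcard
      _ ≤ _ := by
        gcongr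
        rw [hm]
        nlinarith
  · intro x hx
    have hxT : F x ∈ T' := Finset.mem_filter.2 ⟨hFT x hx, x, hx, rfl⟩
    refine ⟨g (F x), Finset.mem_image_of_mem _ hxT, ?_⟩
    have hF := (hg (F x) hxT).2
    have hmR : (0 : ℝ) < m := by exact_mod_cast hm0
    have hd : ‖e (x - g (F x))‖ ≤ 1 / m := by
      refine (pi_norm_le_iff_of_nonneg (by positivity)).2 fun i => ?_
      have h1 : ⌊(m : ℝ) * e x i⌋ = ⌊(m : ℝ) * e (g (F x)) i⌋ := (congrFun hF i).symm
      have h2 := Int.abs_sub_lt_one_of_floor_eq_floor h1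
      rw [← mul_sub, abs_mul, abs_of_pos hmR] at h2
      rw [map_sub, Pi.sub_apply, Real.norm_eq_abs, le_div_iff₀ hmR]
      linarith
    calc ‖x - g (F x)‖ = ‖(e.symm : (Fin k → ℝ) →L[ℝ] E) (e (x - g (F x)))‖ := by simp
      _ ≤ ‖(e.symm : (Fin k → ℝ) →L[ℝ] E)‖ * ‖e (x - g (F x))‖ :=
        (e.symm : (Fin k → ℝ) →L[ℝ] E).le_opNorm _
      _ ≤ (A + 1) * (1 / m) := by gcongr; linarith
      _ = 1 / n := by
        rw [hm]; push_cast
        have : (n : ℝ) ≠ 0 := by positivity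
        field_simp

/-- If almost surely some `φ j` has product at least one over the sample and integral at most
`1 + δ - H`, then the expectation of `n * H` exceeds the logarithm of the number of the `φ j` by at
most a constant. Pointwise `n * H` is at most `log N + exp (n * H) / N`, and `exp (n * H)` is at most
`∑ j, exp (n * (1 + δ - ∫ φ j)) * ∏ i, φ j (s i)`, each term of which has expectation at most
`exp (n * δ)`. -/
theorem lintegral_risk_le_log_card_add_exp {Z ι : Type*} [MeasurableSpace Z] (P : Measure Z)
    [IsProbabilityMeasure P] {J : Finset ι} (hJ : J.Nonempty) {φ : ι → Z → ℝ}
    (hφ0 : ∀ j ∈ J, ∀ z, 0 ≤ φ j z) (hφi : ∀ j ∈ J, Integrable (φ j) P) (n : ℕ) (δ : ℝ)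
    (H : (Fin n → Z) → ℝ)
    (hH : ∀ᵐ s ∂(Measure.pi fun _ : Fin n => P), ∃ j ∈ J,
      1 ≤ ∏ i, φ j (s i) ∧ H s ≤ 1 + δ - ∫ z, φ j z ∂P) :
    ∫⁻ s, ENNReal.ofReal (n * H s) ∂(Measure.pi fun _ : Fin n => P)
      ≤ ENNReal.ofReal (Real.log J.card + Real.exp (n * δ)) := by
  set Q := Measure.pi fun _ : Fin n => P with hQ
  set N : ℝ := (J.card : ℝ) with hN
  have hN0 : 0 < N := by simpa [hN] using hJ.card_pos
  let W : ι → ℝ := fun j => ∫ z, φ j z ∂P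
  let g : (Fin n → Z) → ℝ := fun s =>
    Real.log N + N⁻¹ * ∑ j ∈ J, Real.exp (n * (1 + δ - W j)) * ∏ i, φ j (s i)
  have hprod : ∀ j ∈ J, Integrable (fun s : Fin n → Z => ∏ i, φ j (s i)) Q := fun j hj =>
    Integrable.fintype_prod (f := fun _ => φ j) fun _ => hφi j hj
  have hgi : Integrable g Q := by
    refine (integrable_const _).add (Integrable.const_mul ?_ _)
    exact integrable_finsetSum _ fun j hj => (hprod j hj).const_mul _
  have hsum0 : ∀ s : Fin n → Z, ∀ j ∈ J, 0 ≤ Real.exp (n * (1 + δ - W j)) * ∏ i, φ j (s i) :=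
    fun s j hj => mul_nonneg (Real.exp_pos _).le (Finset.prod_nonneg fun i _ => hφ0 j hj _)
  have hlogN : 0 ≤ Real.log N := Real.log_nonneg (by
    rw [hN]; exact_mod_cast hJ.card_pos)
  have hg0 : ∀ s, 0 ≤ g s := fun s =>
    add_nonneg hlogN (mul_nonneg (inv_nonneg.2 hN0.le) (Finset.sum_nonneg (hsum0 s)))
  have hle : ∀ᵐ s ∂Q, n * H s ≤ g s := by
    filter_upwards [hH] with s hs
    obtain ⟨j, hj, h1, h2⟩ := hs
    have hx : ((n : ℝ) * H s - Real.log N) + 1 ≤ Real.exp (n * H s - Real.log N) :=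
      Real.add_one_le_exp _
    rw [Real.exp_sub, Real.exp_log hN0] at hx
    have h3 : Real.exp (n * H s) ≤ Real.exp (n * (1 + δ - W j)) * ∏ i, φ j (s i) := by
      calc Real.exp (n * H s) ≤ Real.exp (n * (1 + δ - W j)) :=
            Real.exp_le_exp.2 (by gcongr)
        _ ≤ _ := le_mul_of_one_le_right (Real.exp_pos _).le h1
    have h4 := h3.trans (Finset.single_le_sum (hsum0 s) hj)
    have h5 : Real.exp (n * H s) / N ≤
        N⁻¹ * ∑ j ∈ J, Real.exp (n * (1 + δ - W j)) * ∏ i, φ j (s i) := by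
      rw [div_eq_inv_mul]; gcongr
    simp only [g]
    linarith
  have hint : ∫ s, g s ∂Q ≤ Real.log N + Real.exp (n * δ) := by
    have e1 : ∫ s, g s ∂Q = Real.log N + N⁻¹ * ∑ j ∈ J, Real.exp (n * (1 + δ - W j)) * W j ^ n := by
      rw [integral_add (integrable_const _)
        ((integrable_finsetSum _ fun j hj => (hprod j hj).const_mul _).const_mul _),
        integral_const_mul, integral_finsetSum _ fun j hj => (hprod j hj).const_mul _]
      simp only [integral_const, probReal_univ, one_smul, integral_const_mul]
      congr 3
      funext j
      rw [integral_fintype_prod_eq_pow (φ j), Fintype.card_fin]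
    rw [e1]
    gcongr
    have hterm : ∀ j ∈ J, Real.exp (n * (1 + δ - W j)) * W j ^ n ≤ Real.exp (n * δ) := by
      intro j hj
      have hW0 : 0 ≤ W j := integral_nonneg (hφ0 j hj)
      have hW : W j ≤ Real.exp (W j - 1) := by linarith [Real.add_one_le_exp (W j - 1)]
      calc Real.exp (n * (1 + δ - W j)) * W j ^ n
          ≤ Real.exp (n * (1 + δ - W j)) * Real.exp (W j - 1) ^ n := by gcongr
        _ = Real.exp (n * δ) := by
          rw [← Real.exp_nat_mul, ← Real.exp_add]; congr 1; ring
    calc N⁻¹ * ∑ j ∈ J, Real.exp (n * (1 + δ - W j)) * W j ^ n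
        ≤ N⁻¹ * ∑ _j ∈ J, Real.exp (n * δ) := by
          gcongr with j hj; exact hterm j hj
      _ = Real.exp (n * δ) := by
          rw [Finset.sum_const, nsmul_eq_mul, ← hN, inv_mul_cancel_left₀ hN0.ne']
  calc ∫⁻ s, ENNReal.ofReal (n * H s) ∂Q ≤ ∫⁻ s, ENNReal.ofReal (g s) ∂Q :=
        lintegral_mono_ae (hle.mono fun s hs => ENNReal.ofReal_le_ofReal hs)
    _ = ENNReal.ofReal (∫ s, g s ∂Q) :=
        (ofReal_integral_eq_lintegral_ofReal hgi (ae_of_all _ hg0)).symm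
    _ ≤ _ := ENNReal.ofReal_le_ofReal hint

section Affinity

variable {Z : Type*} [MeasurableSpace Z] {ρ : Measure Z} {u p r : Z → ℝ}

theorem integrable_sqrt_mul (hu : Measurable u) (hr : Measurable r) (hu0 : ∀ z, 0 ≤ u z)
    (hr0 : ∀ z, 0 ≤ r z) (hui : Integrable u ρ) (hri : Integrable r ρ) :
    Integrable (fun z => √(u z * r z)) ρ := by
  refine (hui.add hri).mono (by fun_prop) (ae_of_all _ fun z => ?_)
  have h1 := hu0 z
  have h2 := hr0 z
  rw [Real.norm_of_nonneg (Real.sqrt_nonneg _), Pi.add_apply, Real.norm_of_nonneg (by positivity)]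
  refine Real.sqrt_le_iff.2 ⟨by positivity, ?_⟩
  nlinarith [mul_nonneg h1 h2, sq_nonneg (u z), sq_nonneg (r z)]

theorem sq_sqrt_sub_sqrt {a b : ℝ} (ha : 0 ≤ a) (hb : 0 ≤ b) :
    (√a - √b) ^ 2 = a + b - 2 * √(a * b) := by
  rw [Real.sqrt_mul ha, sub_sq, Real.sq_sqrt ha, Real.sq_sqrt hb]; ring

theorem integrable_sq_sqrt_sub_sqrt (hu : Measurable u) (hr : Measurable r) (hu0 : ∀ z, 0 ≤ u z)
    (hr0 : ∀ z, 0 ≤ r z) (hui : Integrable u ρ) (hri : Integrable r ρ) :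
    Integrable (fun z => (√(u z) - √(r z)) ^ 2) ρ := by
  simp_rw [fun z => sq_sqrt_sub_sqrt (hu0 z) (hr0 z)]
  exact (hui.add hri).sub ((integrable_sqrt_mul hu hr hu0 hr0 hui hri).const_mul 2)

/-- The affinity of `r` with an upper bracket `u` of the density `p` falls short of `1 + δ` by at
least half of the squared Hellinger distance of `p` and `r`. -/
theorem integral_sq_sqrt_sub_sqrt_le (hu : Measurable u) (hp : Measurable p) (hr : Measurable r)
    (hu0 : ∀ z, 0 ≤ u z) (hp0 : ∀ z, 0 ≤ p z) (hr0 : ∀ z, 0 ≤ r z)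
    (hui : Integrable u ρ) (hpi : Integrable p ρ) (hri : Integrable r ρ)
    (hp1 : ∫ z, p z ∂ρ = 1) (hr1 : ∫ z, r z ∂ρ = 1) (hpu : ∀ᵐ z ∂ρ, p z ≤ u z)
    {δ : ℝ} (hu1 : ∫ z, u z ∂ρ ≤ 1 + δ) :
    1 / 2 * (1 / 2 * ∫ z, (√(p z) - √(r z)) ^ 2 ∂ρ) ≤ 1 + δ - ∫ z, √(u z * r z) ∂ρ := by
  have hW := integrable_sqrt_mul hu hr hu0 hr0 hui hri
  have e1 : ∫ z, (√(u z) - √(r z)) ^ 2 ∂ρ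
      = ∫ z, u z ∂ρ + 1 - 2 * ∫ z, √(u z * r z) ∂ρ := by
    simp_rw [fun z => sq_sqrt_sub_sqrt (hu0 z) (hr0 z)]
    rw [integral_sub (f := fun z => u z + r z) (hui.add hri) (hW.const_mul 2),
      integral_add hui hri, integral_const_mul, hr1]
  have e2 : ∫ z, (√(p z) - √(r z)) ^ 2 ∂ρ
      ≤ ∫ z, (2 * (√(u z) - √(r z)) ^ 2 + 2 * (u z - p z)) ∂ρ := by
    refine integral_mono_ae (integrable_sq_sqrt_sub_sqrt hp hr hp0 hr0 hpi hri)
      (((integrable_sq_sqrt_sub_sqrt hu hr hu0 hr0 hui hri).const_mul 2).add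
        ((hui.sub hpi).const_mul 2)) ?_
    filter_upwards [hpu] with z hz
    have h1 : √(p z) ≤ √(u z) := Real.sqrt_le_sqrt hz
    have h2 := Real.sq_sqrt (hp0 z)
    have h3 := Real.sq_sqrt (hu0 z)
    have h4 := Real.sqrt_nonneg (p z)
    -- `√p` is compared with `√r` through `√u`, at the price of a factor two
    have h5 : (√(u z) - √(p z)) ^ 2 ≤ u z - p z := by nlinarith
    show _ ≤ 2 * (√(u z) - √(r z)) ^ 2 + 2 * (u z - p z)
    nlinarith [sq_nonneg ((√(u z) - √(r z)) + (√(u z) - √(p z)))]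
  rw [integral_add (g := fun z => 2 * (u z - p z))
    ((integrable_sq_sqrt_sub_sqrt hu hr hu0 hr0 hui hri).const_mul 2) ((hui.sub hpi).const_mul 2),
    integral_const_mul, integral_const_mul, integral_sub hui hpi,
    e1, hp1] at e2
  linarith

theorem sqrt_div_mul_self {a b : ℝ} (hb : 0 < b) : b * √(a / b) = √(a * b) := by
  rw [show a * b = b ^ 2 * (a / b) by field_simp, Real.sqrt_mul (by positivity),
    Real.sqrt_sq hb.le]

theorem integrable_sqrt_div_withDensity (hu : Measurable u) (hr : Measurable r)
    (hu0 : ∀ z, 0 ≤ u z) (hr0 : ∀ z, 0 < r z) (hui : Integrable u ρ) (hri : Integrable r ρ) :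
    Integrable (fun z => √(u z / r z)) (ρ.withDensity fun z => ENNReal.ofReal (r z)) := by
  rw [integrable_withDensity_iff_integrable_smul' (by fun_prop) (by simp)]
  refine (integrable_sqrt_mul hu hr hu0 (fun z => (hr0 z).le) hui hri).congr
    (ae_of_all _ fun z => ?_)
  simp only [ENNReal.toReal_ofReal (hr0 z).le, smul_eq_mul]
  exact (sqrt_div_mul_self (hr0 z)).symm

theorem integral_sqrt_div_withDensity (hr : Measurable r) (hr0 : ∀ z, 0 < r z) :
    ∫ z, √(u z / r z) ∂(ρ.withDensity fun z => ENNReal.ofReal (r z)) = ∫ z, √(u z * r z) ∂ρ := by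
  rw [integral_withDensity_eq_integral_toReal_smul (by fun_prop) (by simp)]
  refine integral_congr_ae (ae_of_all _ fun z => ?_)
  simp only [ENNReal.toReal_ofReal (hr0 z).le, smul_eq_mul]
  exact sqrt_div_mul_self (hr0 z)

/-- The square of the `L¹` distance of two densities is at most eight times their squared Hellinger
distance, as follows from `|p - r| = |√p - √r| (√p + √r)` and the Cauchy-Schwarz inequality. -/
theorem sq_integral_abs_sub_le (hp : Measurable p) (hr : Measurable r)
    (hp0 : ∀ z, 0 ≤ p z) (hr0 : ∀ z, 0 ≤ r z) (hpi : Integrable p ρ) (hri : Integrable r ρ)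
    (hp1 : ∫ z, p z ∂ρ = 1) (hr1 : ∫ z, r z ∂ρ = 1) :
    (∫ z, |p z - r z| ∂ρ) ^ 2 ≤ 4 * ∫ z, (√(p z) - √(r z)) ^ 2 ∂ρ := by
  set A := ∫ z, (√(p z) - √(r z)) ^ 2 ∂ρ
  set B := ∫ z, |p z - r z| ∂ρ with hB
  have hA0 : 0 ≤ A := integral_nonneg fun z => sq_nonneg _
  have hB0 : 0 ≤ B := integral_nonneg fun z => abs_nonneg _
  -- the Cauchy-Schwarz inequality in its polarized form; `t = 4 / B` is used below
  have key : ∀ t : ℝ, 2 * t * B ≤ t ^ 2 * A + 4 := by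
    intro t
    have hs := integrable_sq_sqrt_sub_sqrt hp hr hp0 hr0 hpi hri
    have h1 : ∫ z, 2 * t * |p z - r z| ∂ρ
        ≤ ∫ z, (t ^ 2 * (√(p z) - √(r z)) ^ 2 + 2 * (p z + r z)) ∂ρ := by
      refine integral_mono ((hpi.sub hri).abs.const_mul _)
        ((hs.const_mul _).add ((hpi.add hri).const_mul 2)) fun z => ?_
      show 2 * t * |p z - r z| ≤ t ^ 2 * (√(p z) - √(r z)) ^ 2 + 2 * (p z + r z)
      have h2 := Real.sq_sqrt (hp0 z)
      have h3 := Real.sq_sqrt (hr0 z)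
      have h4 : |p z - r z| = |√(p z) - √(r z)| * (√(p z) + √(r z)) := by
        calc |p z - r z| = |(√(p z) - √(r z)) * (√(p z) + √(r z))| := by congr 1; nlinarith
          _ = _ := by
            rw [abs_mul, abs_of_nonneg (add_nonneg (Real.sqrt_nonneg (p z)) (Real.sqrt_nonneg _))]
      rw [h4, ← sq_abs (√(p z) - √(r z))]
      nlinarith [sq_nonneg (t * |√(p z) - √(r z)| - (√(p z) + √(r z))),
        sq_nonneg (√(p z) - √(r z))]
    rw [integral_const_mul, integral_add (hs.const_mul _)
      (g := fun z => 2 * (p z + r z)) ((hpi.add hri).const_mul 2),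
      integral_const_mul, integral_const_mul, integral_add hpi hri, hp1, hr1] at h1
    linarith
  rcases hB0.eq_or_lt with h0 | h0
  · rw [← h0]; nlinarith
  · have h1 := key (4 / B)
    have h2 : 2 * (4 / B) * B = 8 := by field_simp; norm_num
    rw [h2] at h1
    have h3 : 4 * B ^ 2 ≤ 16 * A := by
      have h4 : (4 / B) ^ 2 * A = 16 * A / B ^ 2 := by rw [div_pow]; ring
      rw [h4] at h1
      rw [← le_div_iff₀ (by positivity)]
      linarith
    linarith

end Affinity

end

/-! ### The model densities and the Hellinger distance -/

section

theorem promptDensity_pos {m v : ℝ} (hv : 0 < v) (y : ℝ) : 0 < promptDensity m v y :=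
  gaussianPDFReal_pos _ _ _ (by simpa using hv)

theorem promptDensity_nonneg (m v y : ℝ) : 0 ≤ promptDensity m v y :=
  gaussianPDFReal_nonneg _ _ _

theorem integrable_promptDensity (m v : ℝ) : Integrable (promptDensity m v) :=
  integrable_gaussianPDFReal _ _

theorem integral_promptDensity {m v : ℝ} (hv : 0 < v) : ∫ y, promptDensity m v y = 1 :=
  integral_gaussianPDFReal_eq_one _ (by simpa using hv)

theorem promptDensity_eq {m v : ℝ} (hv : 0 < v) (y : ℝ) :
    promptDensity m v y = (√(2 * Real.pi * v))⁻¹ * Real.exp (-(y - m) ^ 2 / (2 * v)) := by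
  simp only [promptDensity, gaussianPDFReal, Real.coe_toNNReal v hv.le]

theorem measurable_promptDensity {α : Type*} [MeasurableSpace α] {m v y : α → ℝ}
    (hm : Measurable m) (hv : Measurable v) (hy : Measurable y) :
    Measurable fun a => promptDensity (m a) (v a) (y a) :=
  measurable_uncurry_gaussianPDFReal.comp (hm.prodMk (hv.real_toNNReal.prodMk hy))

variable {d q : ℕ} {μ : Measure (EuclideanSpace ℝ (Fin d))}
  {g₀ : EuclideanSpace ℝ (Fin d) → ℝ → ℝ}
  {h : EuclideanSpace ℝ (Fin d) → EuclideanSpace ℝ (Fin q) → ℝ} {G G' : Param d q}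

theorem IsConditionalDensity.integrable (hg : IsConditionalDensity g₀)
    (x : EuclideanSpace ℝ (Fin d)) : Integrable (g₀ x) :=
  not_imp_comm.1 integral_undef (by rw [hg.integral_eq_one x]; exact one_ne_zero)

theorem IsConditionalDensity.integrable_prod [IsProbabilityMeasure μ]
    (hg : IsConditionalDensity g₀) :
    Integrable (fun z : EuclideanSpace ℝ (Fin d) × ℝ => g₀ z.1 z.2)
      (μ.prod (volume : Measure ℝ)) := by
  refine (integrable_prod_iff hg.measurable.aestronglyMeasurable).2
    ⟨ae_of_all _ fun x => hg.integrable x, ?_⟩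
  simp only [fun x y => Real.norm_of_nonneg (hg.nonneg x y), hg.integral_eq_one]
  exact integrable_const _

theorem IsConditionalDensity.integral_prod_eq_one [IsProbabilityMeasure μ]
    (hg : IsConditionalDensity g₀) :
    ∫ z, g₀ z.1 z.2 ∂(μ.prod (volume : Measure ℝ)) = 1 := by
  rw [integral_prod _ hg.integrable_prod]
  simp [hg.integral_eq_one]

theorem modelDensity_pos (hg : IsConditionalDensity g₀) (hG : 0 < G.ν)
    (x : EuclideanSpace ℝ (Fin d)) (y : ℝ) : 0 < modelDensity g₀ h G x y := by
  have h1 := hg.nonneg x y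
  have h2 := promptDensity_pos (m := h x G.η) hG y
  unfold modelDensity
  positivity

theorem isConditionalDensity_modelDensity (hg : IsConditionalDensity g₀)
    (hh : Measurable fun x => h x G.η) (hG : 0 < G.ν) :
    IsConditionalDensity (modelDensity g₀ h G) where
  measurable := by
    have h1 := hg.measurable
    have h2 : Measurable fun z : EuclideanSpace ℝ (Fin d) × ℝ =>
        promptDensity (h z.1 G.η) G.ν z.2 :=
      measurable_promptDensity (hh.comp measurable_fst) measurable_const measurable_snd
    unfold modelDensity
    fun_prop
  nonneg x y := (modelDensity_pos hg hG x y).le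
  integral_eq_one x := by
    unfold modelDensity
    rw [integral_add ((hg.integrable x).const_mul _) ((integrable_promptDensity _ _).const_mul _),
      integral_const_mul, integral_const_mul, hg.integral_eq_one, integral_promptDensity hG]
    field_simp

theorem isProbabilityMeasure_pairLaw [IsProbabilityMeasure μ] (hg : IsConditionalDensity g₀)
    (hh : Measurable fun x => h x G.η) (hG : 0 < G.ν) :
    IsProbabilityMeasure (pairLaw μ g₀ h G) := by
  have hp := isConditionalDensity_modelDensity hg hh hG
  refine ⟨?_⟩
  rw [pairLaw, withDensity_apply _ MeasurableSet.univ, Measure.restrict_univ,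
    ← ofReal_integral_eq_lintegral_ofReal hp.integrable_prod
    (ae_of_all _ fun z => hp.nonneg _ _), hp.integral_prod_eq_one, ENNReal.ofReal_one]

section Hellinger

variable {p r : EuclideanSpace ℝ (Fin d) → ℝ → ℝ}

theorem hellinger_nonneg (p r : ℝ → ℝ) : 0 ≤ hellinger p r := Real.sqrt_nonneg _

theorem sq_hellinger (p r : ℝ → ℝ) :
    hellinger p r ^ 2 = 1 / 2 * ∫ y, (√(p y) - √(r y)) ^ 2 := by
  rw [hellinger, Real.sq_sqrt]
  have : 0 ≤ ∫ y, (√(p y) - √(r y)) ^ 2 := integral_nonneg fun y => sq_nonneg _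
  positivity

theorem IsConditionalDensity.measurable_section (hp : IsConditionalDensity p)
    (x : EuclideanSpace ℝ (Fin d)) : Measurable (p x) :=
  hp.measurable.comp measurable_prodMk_left

theorem hellinger_le_one (hp : IsConditionalDensity p) (hr : IsConditionalDensity r)
    (x : EuclideanSpace ℝ (Fin d)) : hellinger (p x) (r x) ≤ 1 := by
  refine (sq_le_one_iff₀ (hellinger_nonneg _ _)).1 ?_
  rw [sq_hellinger]
  have h1 : ∫ y, (√(p x y) - √(r x y)) ^ 2 ≤ ∫ y, (p x y + r x y) := by
    refine integral_mono (integrable_sq_sqrt_sub_sqrt (hp.measurable_section x)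
      (hr.measurable_section x) (hp.nonneg x) (hr.nonneg x) (hp.integrable x) (hr.integrable x))
      ((hp.integrable x).add (hr.integrable x)) fun y => ?_
    show (√(p x y) - √(r x y)) ^ 2 ≤ p x y + r x y
    rw [sq_sqrt_sub_sqrt (hp.nonneg x y) (hr.nonneg x y)]
    linarith [Real.sqrt_nonneg (p x y * r x y)]
  rw [integral_add (hp.integrable x) (hr.integrable x), hp.integral_eq_one,
    hr.integral_eq_one] at h1
  linarith

theorem measurable_hellinger (hp : IsConditionalDensity p) (hr : IsConditionalDensity r) :
    Measurable fun x => hellinger (p x) (r x) := by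
  have hm : Measurable fun z : EuclideanSpace ℝ (Fin d) × ℝ =>
      (√(p z.1 z.2) - √(r z.1 z.2)) ^ 2 := by
    have h1 := hp.measurable
    have h2 := hr.measurable
    fun_prop
  exact Measurable.sqrt ((hm.stronglyMeasurable.integral_prod_right').measurable.const_mul _)

theorem integrable_hellinger [IsFiniteMeasure μ] (hp : IsConditionalDensity p)
    (hr : IsConditionalDensity r) : Integrable (fun x => hellinger (p x) (r x)) μ :=
  Integrable.of_bound (measurable_hellinger hp hr).aestronglyMeasurable 1
    (ae_of_all _ fun x => by
      rw [Real.norm_of_nonneg (hellinger_nonneg _ _)]; exact hellinger_le_one hp hr x)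

/-- The squared mean of the conditional Hellinger distances is at most the squared Hellinger distance
of the joint densities. -/
theorem sq_integral_hellinger_le [IsProbabilityMeasure μ] (hp : IsConditionalDensity p)
    (hr : IsConditionalDensity r) :
    (∫ x, hellinger (p x) (r x) ∂μ) ^ 2 ≤
      1 / 2 * ∫ z, (√(p z.1 z.2) - √(r z.1 z.2)) ^ 2 ∂(μ.prod (volume : Measure ℝ)) := by
  have hi := integrable_hellinger (μ := μ) hp hr
  have hsq : Integrable (fun x => hellinger (p x) (r x) ^ 2) μ :=
    Integrable.of_bound ((measurable_hellinger hp hr).pow_const 2).aestronglyMeasurable 1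
      (ae_of_all _ fun x => by
        rw [Real.norm_of_nonneg (sq_nonneg _)]
        exact (sq_le_one_iff₀ (hellinger_nonneg _ _)).2 (hellinger_le_one hp hr x))
  set B := ∫ x, hellinger (p x) (r x) ∂μ
  have h1 : ∫ x, (2 * B * hellinger (p x) (r x) - B ^ 2) ∂μ ≤ ∫ x, hellinger (p x) (r x) ^ 2 ∂μ :=
    integral_mono ((hi.const_mul _).sub (integrable_const _)) hsq fun x => by
      show 2 * B * hellinger (p x) (r x) - B ^ 2 ≤ hellinger (p x) (r x) ^ 2
      nlinarith [sq_nonneg (hellinger (p x) (r x) - B)]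
  rw [integral_sub (hi.const_mul _) (integrable_const _), integral_const_mul] at h1
  simp only [integral_const, probReal_univ, one_smul] at h1
  rw [integral_prod _ (integrable_sq_sqrt_sub_sqrt hp.measurable hr.measurable
    (fun z => hp.nonneg _ _) (fun z => hr.nonneg _ _) hp.integrable_prod hr.integrable_prod),
    ← integral_const_mul]
  simp_rw [sq_hellinger] at h1
  calc B ^ 2 = 2 * B * B - B ^ 2 := by ring
    _ ≤ _ := h1

theorem integral_abs_sub_le_hellinger [IsProbabilityMeasure μ] (hp : IsConditionalDensity p)
    (hr : IsConditionalDensity r) :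
    ∫ z, |p z.1 z.2 - r z.1 z.2| ∂(μ.prod (volume : Measure ℝ)) ≤
      3 * ∫ x, hellinger (p x) (r x) ∂μ := by
  have hi := (hp.integrable_prod.sub hr.integrable_prod (μ := μ.prod (volume : Measure ℝ))).abs
  rw [integral_prod (fun z : EuclideanSpace ℝ (Fin d) × ℝ => |p z.1 z.2 - r z.1 z.2|) hi,
    ← integral_const_mul]
  refine integral_mono hi.integral_prod_left ((integrable_hellinger hp hr).const_mul 3)
    fun x => ?_
  have h1 := sq_integral_abs_sub_le (hp.measurable_section x)
      (hr.measurable_section x) (hp.nonneg x) (hr.nonneg x) (hp.integrable x) (hr.integrable x)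
      (hp.integral_eq_one x) (hr.integral_eq_one x)
  have h2 := sq_hellinger (p x) (r x)
  have h3 : 0 ≤ hellinger (p x) (r x) := hellinger_nonneg _ _
  show ∫ y, |p x y - r x y| ≤ 3 * hellinger (p x) (r x)
  refine abs_le_of_sq_le_sq' ?_ (by positivity) |>.2
  nlinarith

end Hellinger

end

/-! ### Envelopes of Gaussian densities and of gates -/

section

/-- The envelope of the Gaussian densities of variance `w` whose means lie within `a` of `m`:
at `y` the mean is placed at the point of `[m - a, m + a]` closest to `y`. -/
def gaussianEnvelope (m a w y : ℝ) : ℝ := promptDensity (max (m - a) (min (m + a) y)) w y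

theorem promptDensity_le_of_abs_sub_le {m m' v y : ℝ} (hv : 0 < v) (h : |y - m'| ≤ |y - m|) :
    promptDensity m v y ≤ promptDensity m' v y := by
  rw [promptDensity_eq hv, promptDensity_eq hv]
  have := sq_le_sq.2 h
  gcongr

theorem promptDensity_le_gaussianEnvelope {m m' a w y : ℝ} (hw : 0 < w) (h : |m' - m| ≤ a) :
    promptDensity m' w y ≤ gaussianEnvelope m a w y := by
  refine promptDensity_le_of_abs_sub_le hw ?_
  obtain ⟨h1, h2⟩ := abs_le.1 h
  rcases le_total y (m - a) with hy | hy
  · rw [min_eq_right (by linarith), max_eq_left hy, abs_of_nonpos (by linarith),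
      abs_of_nonpos (by linarith)]
    linarith
  · rcases le_total y (m + a) with hy' | hy'
    · rw [min_eq_right hy', max_eq_right hy]
      simp
    · rw [min_eq_left hy', max_eq_right (by linarith), abs_of_nonneg (by linarith),
        abs_of_nonneg (by linarith)]
      linarith

/-- Only the normalizing constant of a Gaussian density decreases when its variance grows. -/
theorem promptDensity_le_mul_of_le {m v w y : ℝ} (hv : 0 < v) (hvw : v ≤ w) :
    promptDensity m v y ≤ w / v * promptDensity m w y := by
  have hw : 0 < w := hv.trans_le hvw
  rw [promptDensity_eq hv, promptDensity_eq hw, ← mul_assoc]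
  have h1 : (√(2 * Real.pi * v))⁻¹ ≤ w / v * (√(2 * Real.pi * w))⁻¹ := by
    have hs : 0 < √(2 * Real.pi * v) := Real.sqrt_pos.2 (by positivity)
    have hs' : 0 < √(2 * Real.pi * w) := Real.sqrt_pos.2 (by positivity)
    have h2 : √(2 * Real.pi * w) ≤ w / v * √(2 * Real.pi * v) := by
      refine Real.sqrt_le_iff.2 ⟨by positivity, ?_⟩
      rw [mul_pow, Real.sq_sqrt (by positivity), div_pow]
      have : w ^ 2 / v ^ 2 * (2 * Real.pi * v) = 2 * Real.pi * w * (w / v) := by field_simp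
      rw [this]
      exact le_mul_of_one_le_right (by positivity) ((one_le_div hv).2 hvw)
    rw [← div_eq_mul_inv, le_div_iff₀ hs', inv_mul_le_iff₀ hs]
    linarith
  have h3 : -(y - m) ^ 2 / (2 * v) ≤ -(y - m) ^ 2 / (2 * w) := by
    rw [neg_div, neg_div]
    gcongr
  gcongr

theorem promptDensity_le_peak {m v : ℝ} (hv : 0 < v) (y : ℝ) :
    promptDensity m v y ≤ (√(2 * Real.pi * v))⁻¹ := by
  rw [promptDensity_eq hv]
  refine mul_le_of_le_one_right (by positivity) (Real.exp_le_one_iff.2 ?_)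
  rw [neg_div]
  have : 0 ≤ (y - m) ^ 2 / (2 * v) := by positivity
  linarith

theorem promptDensity_add_left (m c v y : ℝ) :
    promptDensity (m + c) v (y + c) = promptDensity m v y := by
  simp [promptDensity, gaussianPDFReal]

/-- Cutting `ℝ` at the ends of `[m - a, m + a]`: outside, the envelope is two halves of a Gaussian
density, and inside it is constant. -/
theorem lintegral_gaussianEnvelope_le {m a w : ℝ} (ha : 0 ≤ a) (hw : 0 < w) :
    ∫⁻ y, ENNReal.ofReal (gaussianEnvelope m a w y)
      ≤ ENNReal.ofReal (1 + 2 * a * (√(2 * Real.pi * w))⁻¹) := by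
  have hm : ∀ m, Measurable fun y => ENNReal.ofReal (promptDensity m w y) := fun m =>
    (measurable_promptDensity measurable_const measurable_const measurable_id).ennreal_ofReal
  let f := fun y => ENNReal.ofReal (promptDensity m w y)
  let A : ℝ → ENNReal := (Set.Iic m).indicator f
  let B : ℝ → ENNReal := (Set.Ioi m).indicator f
  let D : ℝ → ENNReal := (Set.Icc (m - a) (m + a)).indicator
    fun _ => ENNReal.ofReal (√(2 * Real.pi * w))⁻¹
  have hA : Measurable A := (hm m).indicator measurableSet_Iic
  have hB : Measurable B := (hm m).indicator measurableSet_Ioi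
  have hle : ∀ y, ENNReal.ofReal (gaussianEnvelope m a w y) ≤ A (y + a) + B (y - a) + D y := by
    intro y
    rcases lt_or_ge y (m - a) with hy | hy
    · have h1 : A (y + a) = ENNReal.ofReal (gaussianEnvelope m a w y) := by
        have : y + a ∈ Set.Iic m := by simp only [Set.mem_Iic]; linarith
        simp only [A, f, Set.indicator_of_mem this, gaussianEnvelope]
        rw [min_eq_right (by linarith), max_eq_left hy.le, ← promptDensity_add_left (m - a) a]
        simp
      rw [← h1, add_assoc]
      exact le_self_add
    · rcases le_or_gt y (m + a) with hy' | hy'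
      · have h1 : D y = ENNReal.ofReal (√(2 * Real.pi * w))⁻¹ :=
          Set.indicator_of_mem (Set.mem_Icc.2 ⟨hy, hy'⟩) _
        rw [h1]
        exact le_add_left (ENNReal.ofReal_le_ofReal (promptDensity_le_peak hw y))
      · have h1 : B (y - a) = ENNReal.ofReal (gaussianEnvelope m a w y) := by
          have : y - a ∈ Set.Ioi m := by simp only [Set.mem_Ioi]; linarith
          simp only [B, f, Set.indicator_of_mem this, gaussianEnvelope]
          rw [min_eq_left hy'.le, max_eq_right (by linarith),
            ← promptDensity_add_left m a w (y - a)]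
          simp
        rw [← h1]
        exact le_add_right le_add_self
  calc ∫⁻ y, ENNReal.ofReal (gaussianEnvelope m a w y)
      ≤ ∫⁻ y, (A (y + a) + B (y - a) + D y) := lintegral_mono hle
    _ = (∫⁻ y, A y) + (∫⁻ y, B y) + ∫⁻ y, D y := by
      rw [lintegral_add_left (by fun_prop), lintegral_add_left (by fun_prop),
        lintegral_add_right_eq_self A a, lintegral_sub_right_eq_self B a]
    _ = 1 + ENNReal.ofReal (2 * a * (√(2 * Real.pi * w))⁻¹) := by
      congr 1
      · rw [← lintegral_add_left hA]
        have : ∀ y, A y + B y = f y := fun y => by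
          have := Set.indicator_self_add_compl_apply (Set.Iic m) f y
          rwa [Set.compl_Iic] at this
        simp_rw [this]
        exact lintegral_gaussianPDFReal_eq_one _ (by simpa using hw)
      · rw [lintegral_indicator measurableSet_Icc, setLIntegral_const, Real.volume_Icc,
          ← ENNReal.ofReal_mul (by positivity)]
        congr 1; ring
    _ = _ := by
      rw [ENNReal.ofReal_add zero_le_one (by positivity), ENNReal.ofReal_one]

theorem measurable_gaussianEnvelope {α : Type*} [MeasurableSpace α] {m a w y : α → ℝ}
    (hm : Measurable m) (ha : Measurable a) (hw : Measurable w) (hy : Measurable y) :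
    Measurable fun z => gaussianEnvelope (m z) (a z) (w z) (y z) :=
  measurable_promptDensity (by fun_prop) hw hy

theorem gaussianEnvelope_nonneg (m a w y : ℝ) : 0 ≤ gaussianEnvelope m a w y :=
  promptDensity_nonneg _ _ _

theorem integrable_gaussianEnvelope {m a w : ℝ} (ha : 0 ≤ a) (hw : 0 < w) :
    Integrable (gaussianEnvelope m a w) :=
  ⟨(measurable_gaussianEnvelope measurable_const measurable_const measurable_const
    measurable_id).aestronglyMeasurable,
    (hasFiniteIntegral_iff_ofReal (ae_of_all _ (gaussianEnvelope_nonneg m a w))).2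
      ((lintegral_gaussianEnvelope_le ha hw).trans_lt ENNReal.ofReal_lt_top)⟩

theorem integral_gaussianEnvelope_le {m a w : ℝ} (ha : 0 ≤ a) (hw : 0 < w) :
    ∫ y, gaussianEnvelope m a w y ≤ 1 + 2 * a * (√(2 * Real.pi * w))⁻¹ := by
  rw [← ENNReal.ofReal_le_ofReal_iff (by positivity), ofReal_integral_eq_lintegral_ofReal
    (integrable_gaussianEnvelope ha hw) (ae_of_all _ (gaussianEnvelope_nonneg m a w))]
  exact lintegral_gaussianEnvelope_le ha hw

theorem one_div_one_add_exp_le {a b t : ℝ} (h : |a - b| ≤ t) :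
    1 / (1 + Real.exp a) ≤ Real.exp t * (1 / (1 + Real.exp b)) := by
  obtain ⟨h1, h2⟩ := abs_le.1 h
  have ht : 1 ≤ Real.exp t := Real.one_le_exp (by linarith)
  have h3 : Real.exp b ≤ Real.exp t * Real.exp a := by
    rw [← Real.exp_add]; exact Real.exp_le_exp.2 (by linarith)
  rw [mul_one_div, div_le_div_iff₀ (by positivity) (by positivity)]
  nlinarith [Real.exp_pos a]

theorem exp_div_one_add_exp_le {a b t : ℝ} (h : |a - b| ≤ t) :
    Real.exp a / (1 + Real.exp a) ≤ Real.exp t * (Real.exp b / (1 + Real.exp b)) := by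
  have e : ∀ c, Real.exp c / (1 + Real.exp c) = 1 / (1 + Real.exp (-c)) := fun c => by
    rw [Real.exp_neg]; field_simp; ring
  rw [e, e]
  refine one_div_one_add_exp_le ?_
  rw [show -a - -b = -(a - b) by ring, abs_neg]
  exact h

end

/-! ### Upper brackets of the model -/

section

variable {d q : ℕ} {μ : Measure (EuclideanSpace ℝ (Fin d))}
  {g₀ : EuclideanSpace ℝ (Fin d) → ℝ → ℝ}
  {h : EuclideanSpace ℝ (Fin d) → EuclideanSpace ℝ (Fin q) → ℝ} {G G' : Param d q}
  {L : EuclideanSpace ℝ (Fin d) → ℝ}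

theorem norm_β_sub_le (G G' : Param d q) : ‖G.β - G'.β‖ ≤ ‖G - G'‖ := norm_fst_le (G - G')

theorem abs_τ_sub_le (G G' : Param d q) : |G.τ - G'.τ| ≤ ‖G - G'‖ :=
  (norm_fst_le (G - G').2).trans (norm_snd_le (G - G'))

theorem norm_η_sub_le (G G' : Param d q) : ‖G.η - G'.η‖ ≤ ‖G - G'‖ :=
  ((norm_fst_le (G - G').2.2).trans (norm_snd_le (G - G').2)).trans (norm_snd_le (G - G'))

theorem abs_ν_sub_le (G G' : Param d q) : |G.ν - G'.ν| ≤ ‖G - G'‖ :=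
  ((norm_snd_le (G - G').2.2).trans (norm_snd_le (G - G').2)).trans (norm_snd_le (G - G'))

/-- Up to a constant factor, an upper bound of all model densities whose parameters lie within `ε`
of `G`, when `L` dominates the derivative of the expert. -/
def envelopeDensity (g₀ : EuclideanSpace ℝ (Fin d) → ℝ → ℝ)
    (h : EuclideanSpace ℝ (Fin d) → EuclideanSpace ℝ (Fin q) → ℝ)
    (L : EuclideanSpace ℝ (Fin d) → ℝ) (ε : ℝ) (G : Param d q)
    (z : EuclideanSpace ℝ (Fin d) × ℝ) : ℝ :=
  1 / (1 + Real.exp (inner ℝ G.β z.1 + G.τ)) * g₀ z.1 z.2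
    + Real.exp (inner ℝ G.β z.1 + G.τ) / (1 + Real.exp (inner ℝ G.β z.1 + G.τ))
      * gaussianEnvelope (h z.1 G.η) (ε * L z.1) (G.ν + ε) z.2

theorem modelDensity_le_envelopeDensity (hg : IsConditionalDensity g₀)
    {x : EuclideanSpace ℝ (Fin d)} {y R r ε ν₁ : ℝ} (hx : ‖x‖ ≤ R)
    (hd : Differentiable ℝ (h x)) (hL : ∀ η, ‖η‖ ≤ r → ‖fderiv ℝ (h x) η‖ ≤ L x)
    (hν₁ : 0 < ν₁) (hGν : ν₁ ≤ G.ν) (hη : ‖G.η‖ ≤ r) (hη' : ‖G'.η‖ ≤ r) (hε : ‖G - G'‖ ≤ ε) :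
    modelDensity g₀ h G x y ≤ Real.exp ((R + 1) * ε) * (1 + 2 * ε / ν₁)
      * envelopeDensity g₀ h L ε G' (x, y) := by
  have hε0 : 0 ≤ ε := (norm_nonneg _).trans hε
  have hz : |(inner ℝ G.β x + G.τ) - (inner ℝ G'.β x + G'.τ)| ≤ (R + 1) * ε := by
    have h1 : (inner ℝ G.β x + G.τ) - (inner ℝ G'.β x + G'.τ)
        = inner ℝ (G.β - G'.β) x + (G.τ - G'.τ) := by rw [inner_sub_left]; ring
    rw [h1]
    calc _ ≤ |inner ℝ (G.β - G'.β) x| + |G.τ - G'.τ| := abs_add_le _ _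
      _ ≤ ‖G.β - G'.β‖ * ‖x‖ + |G.τ - G'.τ| := by gcongr; exact abs_real_inner_le_norm _ _
      _ ≤ ε * R + ε := by
        gcongr
        · exact (norm_β_sub_le _ _).trans hε
        · exact (abs_τ_sub_le _ _).trans hε
      _ = (R + 1) * ε := by ring
  have hm : |h x G.η - h x G'.η| ≤ ε * L x := by
    have h1 := Convex.norm_image_sub_le_of_norm_fderiv_le
      (𝕜 := ℝ) (f := h x) (C := L x) (fun η _ => hd η)
      (fun η hη => hL η (mem_closedBall_zero_iff.1 hη))
      (convex_closedBall (0 : EuclideanSpace ℝ (Fin q)) r) (mem_closedBall_zero_iff.2 hη')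
      (mem_closedBall_zero_iff.2 hη)
    have hL0 : 0 ≤ L x := (norm_nonneg _).trans (hL _ hη)
    calc _ ≤ L x * ‖G.η - G'.η‖ := h1
      _ ≤ L x * ε := by gcongr; exact (norm_η_sub_le _ _).trans hε
      _ = _ := mul_comm _ _
  obtain ⟨hν1, hν2⟩ := abs_le.1 ((abs_ν_sub_le G G').trans hε)
  have hGν0 : 0 < G.ν := hν₁.trans_le hGν
  have hc : 1 ≤ 1 + 2 * ε / ν₁ := by
    have : 0 ≤ 2 * ε / ν₁ := by positivity
    linarith
  have hf : promptDensity (h x G.η) G.ν y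
      ≤ (1 + 2 * ε / ν₁) * gaussianEnvelope (h x G'.η) (ε * L x) (G'.ν + ε) y := by
    have hE := promptDensity_le_gaussianEnvelope (y := y) (w := G'.ν + ε) (by linarith) hm
    have hr : (G'.ν + ε) / G.ν ≤ 1 + 2 * ε / ν₁ := by
      calc (G'.ν + ε) / G.ν ≤ (G.ν + 2 * ε) / G.ν :=
          (div_le_div_iff_of_pos_right hGν0).2 (by linarith)
        _ = 1 + 2 * ε / G.ν := by field_simp
        _ ≤ 1 + 2 * ε / ν₁ := by gcongr
    calc promptDensity (h x G.η) G.ν y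
        ≤ (G'.ν + ε) / G.ν * promptDensity (h x G.η) (G'.ν + ε) y :=
          promptDensity_le_mul_of_le hGν0 (by linarith)
      _ ≤ _ := mul_le_mul hr hE (promptDensity_nonneg _ _ _) (by linarith)
  have h1 : 1 / (1 + Real.exp (inner ℝ G.β x + G.τ)) * g₀ x y ≤
      Real.exp ((R + 1) * ε) * (1 / (1 + Real.exp (inner ℝ G'.β x + G'.τ)))
        * ((1 + 2 * ε / ν₁) * g₀ x y) :=
    mul_le_mul (one_div_one_add_exp_le hz) (le_mul_of_one_le_left (hg.nonneg x y) hc)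
      (hg.nonneg x y) (by positivity)
  have h2 := mul_le_mul (exp_div_one_add_exp_le hz) hf (promptDensity_nonneg _ _ _) (by positivity)
  unfold modelDensity envelopeDensity
  calc _ ≤ _ := add_le_add h1 h2
    _ = _ := by ring

theorem measurable_envelopeDensity (hg : IsConditionalDensity g₀) (hh : Measurable fun x => h x G.η)
    (hL : Measurable L) (ε : ℝ) : Measurable (envelopeDensity g₀ h L ε G) := by
  have h1 := hg.measurable
  have h2 : Measurable fun z : EuclideanSpace ℝ (Fin d) × ℝ =>
      gaussianEnvelope (h z.1 G.η) (ε * L z.1) (G.ν + ε) z.2 :=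
    measurable_gaussianEnvelope (hh.comp measurable_fst)
      ((hL.comp measurable_fst).const_mul ε) measurable_const measurable_snd
  unfold envelopeDensity
  fun_prop

theorem envelopeDensity_nonneg (hg : IsConditionalDensity g₀) (ε : ℝ)
    (z : EuclideanSpace ℝ (Fin d) × ℝ) : 0 ≤ envelopeDensity g₀ h L ε G z := by
  have h1 := hg.nonneg z.1 z.2
  have h2 := gaussianEnvelope_nonneg (h z.1 G.η) (ε * L z.1) (G.ν + ε) z.2
  unfold envelopeDensity
  positivity

theorem integrable_envelopeDensity_section (hg : IsConditionalDensity g₀) {ε ν₁ : ℝ}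
    (hL0 : ∀ x, 0 ≤ L x) (hε : 0 ≤ ε) (hν₁ : 0 < ν₁) (hGν : ν₁ ≤ G.ν)
    (x : EuclideanSpace ℝ (Fin d)) : Integrable fun y => envelopeDensity g₀ h L ε G (x, y) := by
  simp only [envelopeDensity]
  exact ((hg.integrable x).const_mul _).add
    ((integrable_gaussianEnvelope (mul_nonneg hε (hL0 x)) (by linarith)).const_mul _)

theorem integral_envelopeDensity_section_le (hg : IsConditionalDensity g₀) {ε ν₁ : ℝ}
    (hL0 : ∀ x, 0 ≤ L x) (hε : 0 ≤ ε) (hν₁ : 0 < ν₁) (hGν : ν₁ ≤ G.ν)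
    (x : EuclideanSpace ℝ (Fin d)) :
    ∫ y, envelopeDensity g₀ h L ε G (x, y) ≤ 1 + 2 * (√(2 * Real.pi * ν₁))⁻¹ * ε * L x := by
  have ha : 0 ≤ ε * L x := mul_nonneg hε (hL0 x)
  have hw : 0 < G.ν + ε := by linarith
  have h1 := integral_gaussianEnvelope_le (m := h x G.η) ha hw
  have h2 : (√(2 * Real.pi * (G.ν + ε)))⁻¹ ≤ (√(2 * Real.pi * ν₁))⁻¹ := by
    have : 0 < √(2 * Real.pi * ν₁) := Real.sqrt_pos.2 (by positivity)
    gcongr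
    linarith
  have h3 : ∫ y, gaussianEnvelope (h x G.η) (ε * L x) (G.ν + ε) y
      ≤ 1 + 2 * (√(2 * Real.pi * ν₁))⁻¹ * ε * L x := by
    calc _ ≤ _ := h1
      _ ≤ 1 + 2 * (ε * L x) * (√(2 * Real.pi * ν₁))⁻¹ := by gcongr
      _ = _ := by ring
  have h4 : 0 ≤ 2 * (√(2 * Real.pi * ν₁))⁻¹ * ε * L x := by
    have := hL0 x
    positivity
  simp only [envelopeDensity]
  rw [integral_add ((hg.integrable x).const_mul _)
    ((integrable_gaussianEnvelope ha hw).const_mul _), integral_const_mul, integral_const_mul,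
    hg.integral_eq_one]
  set E := Real.exp (inner ℝ G.β x + G.τ)
  have hE : 0 < E := Real.exp_pos _
  calc 1 / (1 + E) * 1 + E / (1 + E) * _
      ≤ 1 / (1 + E) * (1 + 2 * (√(2 * Real.pi * ν₁))⁻¹ * ε * L x)
        + E / (1 + E) * (1 + 2 * (√(2 * Real.pi * ν₁))⁻¹ * ε * L x) := by
        gcongr; linarith
    _ = _ := by field_simp

theorem integrable_envelopeDensity [IsProbabilityMeasure μ] (hg : IsConditionalDensity g₀)
    (hh : Measurable fun x => h x G.η) {ε ν₁ : ℝ} (hL : Measurable L) (hLi : Integrable L μ)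
    (hL0 : ∀ x, 0 ≤ L x) (hε : 0 ≤ ε) (hν₁ : 0 < ν₁) (hGν : ν₁ ≤ G.ν) :
    Integrable (envelopeDensity g₀ h L ε G) (μ.prod (volume : Measure ℝ)) := by
  have hm := (measurable_envelopeDensity (G := G) hg hh hL ε).aestronglyMeasurable
    (μ := μ.prod (volume : Measure ℝ))
  refine (integrable_prod_iff hm).2
    ⟨ae_of_all _ (integrable_envelopeDensity_section hg hL0 hε hν₁ hGν), ?_⟩
  refine ((integrable_const 1).add (hLi.const_mul (2 * (√(2 * Real.pi * ν₁))⁻¹ * ε))).mono'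
    hm.norm.integral_prod_right' (ae_of_all _ fun x => ?_)
  simp only [Real.norm_of_nonneg (envelopeDensity_nonneg hg ε _)]
  rw [Real.norm_of_nonneg (integral_nonneg fun y => envelopeDensity_nonneg hg ε _)]
  exact integral_envelopeDensity_section_le hg hL0 hε hν₁ hGν x

theorem integral_envelopeDensity_le [IsProbabilityMeasure μ] (hg : IsConditionalDensity g₀)
    (hh : Measurable fun x => h x G.η) {ε ν₁ : ℝ} (hL : Measurable L) (hLi : Integrable L μ)
    (hL0 : ∀ x, 0 ≤ L x) (hε : 0 ≤ ε) (hν₁ : 0 < ν₁) (hGν : ν₁ ≤ G.ν) :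
    ∫ z, envelopeDensity g₀ h L ε G z ∂(μ.prod (volume : Measure ℝ))
      ≤ 1 + 2 * (√(2 * Real.pi * ν₁))⁻¹ * ε * ∫ x, L x ∂μ := by
  have hi := integrable_envelopeDensity hg hh hL hLi hL0 hε hν₁ hGν
  rw [integral_prod _ hi]
  calc _ ≤ ∫ x, (1 + 2 * (√(2 * Real.pi * ν₁))⁻¹ * ε * L x) ∂μ :=
        integral_mono hi.integral_prod_left ((integrable_const 1).add (hLi.const_mul _))
          (integral_envelopeDensity_section_le hg hL0 hε hν₁ hGν)
    _ = _ := by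
        rw [integral_add (integrable_const 1) (hLi.const_mul _), integral_const_mul]
        simp

theorem exists_pos_le_ν {Ξ : Set (Param d q)} (hΞ : IsCompact Ξ) (hν : ∀ G ∈ Ξ, 0 < G.ν) :
    ∃ ν₁ : ℝ, 0 < ν₁ ∧ ∀ G ∈ Ξ, ν₁ ≤ G.ν := by
  rcases Ξ.eq_empty_or_nonempty with rfl | hne
  · exact ⟨1, one_pos, by simp⟩
  · have hc : Continuous fun G : Param d q => G.ν := continuous_snd.comp
      (continuous_snd.comp continuous_snd)
    obtain ⟨G, hG, hmin⟩ := hΞ.exists_isMinOn hne hc.continuousOn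
    exact ⟨G.ν, hν G hG, fun G' hG' => hmin hG'⟩

/-- Bracketing of the model from above: for every `n`, polynomially many functions of integral at
most `exp (1 / n)` dominate all model densities over a compact parameter set. The map `π` assigns
to a parameter the index of the function that dominates its density. -/
theorem exists_upper_brackets [IsProbabilityMeasure μ] {X : Set (EuclideanSpace ℝ (Fin d))}
    (hX : Bornology.IsBounded X) (hμX : ∀ᵐ x ∂μ, x ∈ X) (hg : IsConditionalDensity g₀)
    (hh_meas : ∀ η, Measurable fun x => h x η) (hh_diff : ∀ᵐ x ∂μ, ContDiff ℝ 1 (h x))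
    (hh_dom : ∀ R : ℝ, ∃ L : EuclideanSpace ℝ (Fin d) → ℝ, Integrable L μ ∧
      ∀ᵐ x ∂μ, ∀ η : EuclideanSpace ℝ (Fin q), ‖η‖ ≤ R → ‖fderiv ℝ (h x) η‖ ≤ L x)
    {Ξ : Set (Param d q)} (hΞ : IsCompact Ξ) (hν : ∀ G ∈ Ξ, 0 < G.ν) :
    ∃ K k : ℕ, ∀ n : ℕ, 1 ≤ n → ∃ (J : Finset (Param d q))
      (u : Param d q → EuclideanSpace ℝ (Fin d) × ℝ → ℝ) (π : Param d q → Param d q),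
      J.card ≤ (K * n) ^ k ∧
      (∀ G ∈ J, Measurable (u G) ∧ (∀ z, 0 ≤ u G z) ∧
        Integrable (u G) (μ.prod (volume : Measure ℝ)) ∧
        ∫ z, u G z ∂(μ.prod (volume : Measure ℝ)) ≤ Real.exp (1 / n)) ∧
      (∀ G ∈ Ξ, π G ∈ J) ∧
      ∀ᵐ z ∂(μ.prod (volume : Measure ℝ)), ∀ G ∈ Ξ,
        modelDensity g₀ h G z.1 z.2 ≤ u (π G) z := by
  obtain ⟨ν₁, hν₁, hνle⟩ := exists_pos_le_ν hΞ hν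
  obtain ⟨R, hR⟩ := hX.exists_norm_le
  obtain ⟨r, hr⟩ := hΞ.isBounded.exists_norm_le
  have hη : ∀ G ∈ Ξ, ‖G.η‖ ≤ r := fun G hG =>
    (((norm_fst_le G.2.2).trans (norm_snd_le G.2)).trans (norm_snd_le G)).trans (hr G hG)
  obtain ⟨L₀, hL₀i, hL₀⟩ := hh_dom r
  -- a version of the dominating function that is measurable and nonnegative everywhere
  let L : EuclideanSpace ℝ (Fin d) → ℝ := fun x => ‖hL₀i.1.mk L₀ x‖
  have hLm : Measurable L := hL₀i.1.stronglyMeasurable_mk.measurable.norm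
  have hL0 : ∀ x, 0 ≤ L x := fun x => norm_nonneg _
  have hLi : Integrable L μ := (hL₀i.congr hL₀i.1.ae_eq_mk).norm
  have hLdom : ∀ᵐ x ∂μ, ∀ η : EuclideanSpace ℝ (Fin q), ‖η‖ ≤ r → ‖fderiv ℝ (h x) η‖ ≤ L x := by
    filter_upwards [hL₀, hL₀i.1.ae_eq_mk] with x hx hx' η hη
    refine (hx η hη).trans ?_
    rw [hx']
    exact le_abs_self _
  obtain ⟨K, k, hcover⟩ := exists_finset_cover_card_le_pow hΞ.isBounded
  set κ := 2 * (√(2 * Real.pi * ν₁))⁻¹ with hκ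
  -- the envelope at radius `ε` has integral at most `exp (B * ε)`; take `ε = 1 / ((B + 1) * n)`
  obtain ⟨B, hB⟩ := exists_nat_ge ((R + 1) + 2 / ν₁ + κ * ∫ x, L x ∂μ)
  refine ⟨K * (B + 1), k, fun n hn => ?_⟩
  obtain ⟨J, hJΞ, hJcard, hJ⟩ := hcover ((B + 1) * n) (Nat.mul_pos B.succ_pos hn)
  set ε : ℝ := 1 / (((B + 1) * n : ℕ) : ℝ) with hε
  have hε0 : 0 ≤ ε := by positivity
  have hBε : B * ε ≤ 1 / n := by
    have hn' : (0 : ℝ) < n := by exact_mod_cast hn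
    rw [hε]; push_cast
    rw [mul_one_div, div_le_div_iff₀ (by positivity) hn']
    nlinarith
  choose! π hπJ hπ using hJ
  refine ⟨J, fun G z => Real.exp ((R + 1) * ε) * (1 + 2 * ε / ν₁) * envelopeDensity g₀ h L ε G z, π,
    by rw [mul_assoc]; exact hJcard, fun G hG => ?_, hπJ, ?_⟩
  · have hGν := hνle G (hJΞ G hG)
    refine ⟨(measurable_envelopeDensity hg (hh_meas _) hLm ε).const_mul _, fun z => ?_,
      (integrable_envelopeDensity hg (hh_meas _) hLm hLi hL0 hε0 hν₁ hGν).const_mul _, ?_⟩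
    · have := envelopeDensity_nonneg (h := h) (L := L) (G := G) hg ε z
      positivity
    · rw [integral_const_mul]
      have hI : 0 ≤ ∫ x, L x ∂μ := integral_nonneg hL0
      have h1 := integral_envelopeDensity_le (G := G) hg (hh_meas _) hLm hLi hL0 hε0 hν₁ hGν
      have h2 : 1 + 2 * ε / ν₁ ≤ Real.exp (2 * ε / ν₁) := by
        linarith [Real.add_one_le_exp (2 * ε / ν₁)]
      have h3 : 1 + κ * ε * ∫ x, L x ∂μ ≤ Real.exp (κ * ε * ∫ x, L x ∂μ) := by
        linarith [Real.add_one_le_exp (κ * ε * ∫ x, L x ∂μ)]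
      have hint0 : 0 ≤ ∫ z, envelopeDensity g₀ h L ε G z ∂(μ.prod (volume : Measure ℝ)) :=
        integral_nonneg fun z => envelopeDensity_nonneg hg ε z
      calc _ ≤ Real.exp ((R + 1) * ε) * Real.exp (2 * ε / ν₁)
            * Real.exp (κ * ε * ∫ x, L x ∂μ) := by
            gcongr
            exact h1.trans h3
        _ = Real.exp (((R + 1) + 2 / ν₁ + κ * ∫ x, L x ∂μ) * ε) := by
            rw [← Real.exp_add, ← Real.exp_add]; congr 1; ring
        _ ≤ Real.exp (1 / n) := by
            refine Real.exp_le_exp.2 (le_trans ?_ hBε)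
            gcongr
  · have hgood : ∀ᵐ x ∂μ, x ∈ X ∧ ContDiff ℝ 1 (h x) ∧
        ∀ η : EuclideanSpace ℝ (Fin q), ‖η‖ ≤ r → ‖fderiv ℝ (h x) η‖ ≤ L x := by
      filter_upwards [hμX, hh_diff, hLdom] with x h1 h2 h3 using ⟨h1, h2, h3⟩
    filter_upwards [Measure.quasiMeasurePreserving_fst.ae hgood] with z hz G hG
    exact modelDensity_le_envelopeDensity hg (hR _ hz.1) (hz.2.1.differentiable one_ne_zero) hz.2.2
      hν₁ (hνle G hG) (hη G hG) (hη _ (hJΞ _ (hπJ G hG))) (hπ G hG)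

end

/-! ### The Hellinger risk of maximum likelihood estimators -/

section

variable {d q : ℕ} {μ : Measure (EuclideanSpace ℝ (Fin d))}
  {g₀ : EuclideanSpace ℝ (Fin d) → ℝ → ℝ}
  {h : EuclideanSpace ℝ (Fin d) → EuclideanSpace ℝ (Fin q) → ℝ}

theorem one_le_prod_sqrt_div {n : ℕ} {a b c : Fin n → ℝ} (ha : ∀ i, 0 < a i) (hb : ∀ i, 0 < b i)
    (hbc : ∀ i, b i ≤ c i) (hlog : ∑ i, Real.log (a i) ≤ ∑ i, Real.log (b i)) :
    1 ≤ ∏ i, √(c i / a i) := by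
  have h1 : ∏ i, a i ≤ ∏ i, b i := by
    rw [← Real.log_prod fun i _ => (ha i).ne', ← Real.log_prod fun i _ => (hb i).ne'] at hlog
    exact (Real.log_le_log_iff (Finset.prod_pos fun i _ => ha i)
      (Finset.prod_pos fun i _ => hb i)).1 hlog
  have h2 : ∏ i, b i ≤ ∏ i, c i := Finset.prod_le_prod (fun i _ => (hb i).le) fun i _ => hbc i
  rw [← one_le_sq_iff₀ (Finset.prod_nonneg fun i _ => Real.sqrt_nonneg _), ← Finset.prod_pow]
  simp_rw [fun i => Real.sq_sqrt (div_nonneg ((hb i).le.trans (hbc i)) (ha i).le)]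
  rw [Finset.prod_div_distrib, one_le_div (Finset.prod_pos fun i _ => ha i)]
  exact h1.trans h2

theorem log_card_add_exp_le {N K k n : ℕ} (hn : 2 ≤ n) (hN : 0 < N) (hNK : N ≤ (K * n) ^ k)
    {c : ℝ} (hc : 0 ≤ c) : Real.log N + c ≤
      (k + (k * Real.log (K + 1) + c) / Real.log 2) * Real.log n := by
  have hn0 : (0 : ℝ) < n := by positivity
  have hlog2 : 0 < Real.log 2 := Real.log_pos one_lt_two
  have hlogn : Real.log 2 ≤ Real.log n := Real.log_le_log two_pos (by exact_mod_cast hn)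
  have h1 : Real.log N ≤ k * (Real.log (K + 1) + Real.log n) := by
    rw [← Real.log_mul (by positivity) hn0.ne', ← Real.log_pow]
    refine Real.log_le_log (by exact_mod_cast hN) ?_
    calc (N : ℝ) ≤ (K * n) ^ k := by exact_mod_cast hNK
      _ ≤ ((K + 1) * n) ^ k := by gcongr; linarith
  have hK : 0 ≤ Real.log ((K : ℝ) + 1) := Real.log_nonneg (by linarith [K.cast_nonneg (α := ℝ)])
  have h2 : k * Real.log (K + 1) + c ≤ (k * Real.log (K + 1) + c) / Real.log 2 * Real.log n := by
    rw [div_mul_eq_mul_div, le_div_iff₀ hlog2]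
    gcongr
  linarith

/-- The risk of a maximum likelihood estimator in the squared mean Hellinger distance. -/
theorem exists_hellinger_risk_bound [IsProbabilityMeasure μ] {X : Set (EuclideanSpace ℝ (Fin d))}
    (hX : Bornology.IsBounded X) (hμX : ∀ᵐ x ∂μ, x ∈ X) (hg : IsConditionalDensity g₀)
    (hh_meas : ∀ η, Measurable fun x => h x η) (hh_diff : ∀ᵐ x ∂μ, ContDiff ℝ 1 (h x))
    (hh_dom : ∀ R : ℝ, ∃ L : EuclideanSpace ℝ (Fin d) → ℝ, Integrable L μ ∧
      ∀ᵐ x ∂μ, ∀ η : EuclideanSpace ℝ (Fin q), ‖η‖ ≤ R → ‖fderiv ℝ (h x) η‖ ≤ L x)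
    {Ξ : Set (Param d q)} (hΞ : IsCompact Ξ) (hν : ∀ G ∈ Ξ, 0 < G.ν) :
    ∃ C : ℝ, 0 < C ∧ ∀ n : ℕ, 2 ≤ n → ∀ G' ∈ Ξ,
      ∀ Ghat : (Fin n → EuclideanSpace ℝ (Fin d) × ℝ) → Param d q,
        (∀ᵐ s ∂(sampleLaw μ g₀ h G' n), IsMLE g₀ h Ξ s (Ghat s)) →
        ∫⁻ s, ENNReal.ofReal
            ((∫ x, hellinger (modelDensity g₀ h (Ghat s) x) (modelDensity g₀ h G' x) ∂μ) ^ 2)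
          ∂(sampleLaw μ g₀ h G' n) ≤ ENNReal.ofReal (C * (Real.log n / n)) := by
  obtain ⟨K, k, hbr⟩ := exists_upper_brackets hX hμX hg hh_meas hh_diff hh_dom hΞ hν
  set A : ℝ := k + (k * Real.log (K + 1) + Real.exp 2) / Real.log 2 with hA
  have hlog2 : 0 < Real.log 2 := Real.log_pos one_lt_two
  have hA0 : 0 < A := by
    have hK : 0 ≤ Real.log ((K : ℝ) + 1) :=
      Real.log_nonneg (by linarith [K.cast_nonneg (α := ℝ)])
    positivity
  refine ⟨2 * A, by positivity, fun n hn G' hG' Ghat hMLE => ?_⟩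
  obtain ⟨J, u, π, hJcard, hu, hπ, hdom⟩ := hbr n (by omega)
  set ρ := μ.prod (volume : Measure ℝ) with hρ
  have hn0 : (0 : ℝ) < n := by positivity
  have hn2 : (2 : ℝ) ≤ n := by exact_mod_cast hn
  have hJne : J.Nonempty := ⟨_, hπ G' hG'⟩
  have := isProbabilityMeasure_pairLaw (μ := μ) hg (hh_meas G'.η) (hν G' hG')
  have hden : ∀ G ∈ Ξ, IsConditionalDensity (modelDensity g₀ h G) := fun G hG =>
    isConditionalDensity_modelDensity hg (hh_meas _) (hν G hG)
  have hden' := hden G' hG'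
  set r : EuclideanSpace ℝ (Fin d) × ℝ → ℝ := fun z => modelDensity g₀ h G' z.1 z.2 with hr
  have hr0 : ∀ z, 0 < r z := fun z => modelDensity_pos hg (hν G' hG') _ _
  let H : (Fin n → EuclideanSpace ℝ (Fin d) × ℝ) → ℝ := fun s =>
    1 / 2 * (1 / 2 * ∫ z, (√(modelDensity g₀ h (Ghat s) z.1 z.2) - √(r z)) ^ 2 ∂ρ)
  have hδ : Real.exp (1 / n) ≤ 1 + 2 / n := by
    have hn1 : (1 : ℝ) / n ≤ 1 := by rw [div_le_one hn0]; linarith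
    have hn1' : 0 ≤ (1 : ℝ) / n := by positivity
    have h1 := (abs_le.1 (Real.abs_exp_sub_one_sub_id_le (x := 1 / n)
      (by rwa [abs_of_nonneg hn1']))).2
    have h2 : (2 : ℝ) / n = 2 * (1 / n) := by ring
    rw [h2]
    nlinarith
  have hrisk := lintegral_risk_le_log_card_add_exp (pairLaw μ g₀ h G') hJne
    (φ := fun j z => √(u j z / r z)) (fun j _ z => Real.sqrt_nonneg _)
    (fun j hj => integrable_sqrt_div_withDensity (hu j hj).1 hden'.measurable (hu j hj).2.1 hr0
      (hu j hj).2.2.1 hden'.integrable_prod) n (2 / n) H (by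
      have hgood : ∀ᵐ s ∂(sampleLaw μ g₀ h G' n), ∀ i, ∀ G ∈ Ξ,
          modelDensity g₀ h G (s i).1 (s i).2 ≤ u (π G) (s i) :=
        Filter.eventually_all.2 fun i =>
          (Measure.tendsto_eval_ae_ae (μ := fun _ : Fin n => pairLaw μ g₀ h G') (i := i)).eventually
            ((withDensity_absolutelyContinuous ρ _).ae_le hdom)
      filter_upwards [hgood, hMLE] with s hs hsM
      refine ⟨π (Ghat s), hπ _ hsM.1, ?_, ?_⟩
      · exact one_le_prod_sqrt_div (fun i => hr0 (s i))
          (fun i => modelDensity_pos hg (hν _ hsM.1) _ _) (fun i => hs i _ hsM.1) (hsM.2 G' hG')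
      · have hb := hu _ (hπ _ hsM.1)
        have hp := hden _ hsM.1
        have hi := integral_sqrt_div_withDensity (ρ := ρ) (u := u (π (Ghat s)))
          hden'.measurable hr0
        calc H s ≤ 1 + 2 / n - ∫ z, √(u (π (Ghat s)) z * r z) ∂ρ :=
              integral_sq_sqrt_sub_sqrt_le hb.1 hp.measurable hden'.measurable hb.2.1
                (fun z => hp.nonneg _ _) (fun z => hden'.nonneg _ _) hb.2.2.1 hp.integrable_prod
                hden'.integrable_prod hp.integral_prod_eq_one hden'.integral_prod_eq_one
                (hdom.mono fun z hz => hz _ hsM.1) (hb.2.2.2.trans hδ)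
          _ = _ := by rw [← hi]; rfl)
  have hle : ∀ᵐ s ∂(sampleLaw μ g₀ h G' n), ENNReal.ofReal
      ((∫ x, hellinger (modelDensity g₀ h (Ghat s) x) (modelDensity g₀ h G' x) ∂μ) ^ 2)
      ≤ ENNReal.ofReal (2 / n) * ENNReal.ofReal (n * H s) := by
    filter_upwards [hMLE] with s hs
    rw [← ENNReal.ofReal_mul (by positivity)]
    refine ENNReal.ofReal_le_ofReal ((sq_integral_hellinger_le (hden _ hs.1) hden').trans_eq ?_)
    simp only [H]
    field_simp
    rfl
  have hexp : (n : ℝ) * (2 / n) = 2 := by field_simp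
  calc _ ≤ ∫⁻ s, ENNReal.ofReal (2 / n) * ENNReal.ofReal (n * H s) ∂(sampleLaw μ g₀ h G' n) :=
        lintegral_mono_ae hle
    _ = ENNReal.ofReal (2 / n) * ∫⁻ s, ENNReal.ofReal (n * H s) ∂(sampleLaw μ g₀ h G' n) :=
        lintegral_const_mul' _ _ ENNReal.ofReal_ne_top
    _ ≤ ENNReal.ofReal (2 / n) * ENNReal.ofReal (Real.log J.card + Real.exp (n * (2 / n))) := by
        gcongr
        exact hrisk
    _ ≤ ENNReal.ofReal (2 / n) * ENNReal.ofReal (A * Real.log n) := by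
        rw [hexp]
        gcongr
        exact log_card_add_exp_le hn hJne.card_pos hJcard (Real.exp_pos 2).le
    _ = _ := by
        rw [← ENNReal.ofReal_mul (by positivity)]
        congr 1
        ring

end

/-! ### Differentiability of the model in its parameter -/

section

variable {d q : ℕ} {μ : Measure (EuclideanSpace ℝ (Fin d))}
  {g₀ : EuclideanSpace ℝ (Fin d) → ℝ → ℝ}
  {h : EuclideanSpace ℝ (Fin d) → EuclideanSpace ℝ (Fin q) → ℝ}

theorem hasStrictFDerivAt_promptDensity {m v : ℝ} (hv : 0 < v) (y : ℝ) :
    ∃ D : ℝ × ℝ →L[ℝ] ℝ,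
      HasStrictFDerivAt (fun p : ℝ × ℝ => promptDensity p.1 p.2 y) D (m, v) ∧
      ∀ a b, D (a, b) = a * deriv (fun m => promptDensity m v y) m
        + b * deriv (fun v => promptDensity m v y) v := by
  have hc : ContDiffAt ℝ 1 (fun p : ℝ × ℝ => promptDensity p.1 p.2 y) (m, v) := by
    have h1 : ContDiffAt ℝ 1 (fun p : ℝ × ℝ => (√(2 * Real.pi * p.2))⁻¹
        * Real.exp (-(y - p.1) ^ 2 / (2 * p.2))) (m, v) := by
      have e1 : ContDiffAt ℝ 1 (fun p : ℝ × ℝ => 2 * Real.pi * p.2) (m, v) := by fun_prop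
      have e2 := (e1.sqrt (by positivity)).inv (Real.sqrt_pos.2 (by positivity)).ne'
      have e3 : ContDiffAt ℝ 1 (fun p : ℝ × ℝ => -(y - p.1) ^ 2 / (2 * p.2)) (m, v) :=
        ContDiffAt.div (by fun_prop) (by fun_prop) (by positivity)
      exact e2.mul e3.exp
    refine h1.congr_of_eventuallyEq ?_
    have : ∀ᶠ p : ℝ × ℝ in 𝓝 (m, v), 0 < p.2 :=
      continuousAt_snd.eventually (lt_mem_nhds hv)
    filter_upwards [this] with p hp using promptDensity_eq hp y
  have hs := hc.hasStrictFDerivAt one_ne_zero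
  refine ⟨_, hs, fun a b => ?_⟩
  have hm : deriv (fun m => promptDensity m v y) m
      = fderiv ℝ (fun p : ℝ × ℝ => promptDensity p.1 p.2 y) (m, v) (1, 0) :=
    (hs.hasFDerivAt.comp_hasDerivAt (f := fun m' : ℝ => (m', v)) m
      ((hasDerivAt_id m).prodMk (hasDerivAt_const m v))).deriv
  have hv' : deriv (fun v => promptDensity m v y) v
      = fderiv ℝ (fun p : ℝ × ℝ => promptDensity p.1 p.2 y) (m, v) (0, 1) :=
    (hs.hasFDerivAt.comp_hasDerivAt (f := fun v' : ℝ => (m, v')) v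
      ((hasDerivAt_const v m).prodMk (hasDerivAt_id v))).deriv
  rw [hm, hv', ← smul_eq_mul, ← smul_eq_mul, ← map_smul, ← map_smul, ← map_add]
  simp

theorem modelDensity_eq (G : Param d q) (x : EuclideanSpace ℝ (Fin d)) (y : ℝ) :
    modelDensity g₀ h G x y = g₀ x y
      + Real.exp (inner ℝ G.β x + G.τ) / (1 + Real.exp (inner ℝ G.β x + G.τ))
        * (promptDensity (h x G.η) G.ν y - g₀ x y) := by
  unfold modelDensity
  field_simp
  ring

/-- The directional derivative of the model density at `(x, y)` at the parameter `G` in the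
direction `w`. -/
def densityDeriv (g₀ : EuclideanSpace ℝ (Fin d) → ℝ → ℝ)
    (h : EuclideanSpace ℝ (Fin d) → EuclideanSpace ℝ (Fin q) → ℝ) (G w : Param d q)
    (x : EuclideanSpace ℝ (Fin d)) (y : ℝ) : ℝ :=
  Real.exp (inner ℝ G.β x + G.τ) / (1 + Real.exp (inner ℝ G.β x + G.τ)) ^ 2
      * (inner ℝ w.β x + w.τ) * (promptDensity (h x G.η) G.ν y - g₀ x y)
    + Real.exp (inner ℝ G.β x + G.τ) / (1 + Real.exp (inner ℝ G.β x + G.τ))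
      * (fderiv ℝ (h x) G.η w.η * deriv (fun m => promptDensity m G.ν y) (h x G.η)
        + w.ν * deriv (fun v => promptDensity (h x G.η) v y) G.ν)

/-- Strict differentiability controls difference quotients between two moving parameters, neither of
which is the limit, and needs no convexity of the parameter space. -/
theorem hasStrictFDerivAt_modelDensity {G : Param d q} (hG : 0 < G.ν)
    {x : EuclideanSpace ℝ (Fin d)} (hx : ContDiff ℝ 1 (h x)) (y : ℝ) :
    ∃ D : Param d q →L[ℝ] ℝ, HasStrictFDerivAt (fun G => modelDensity g₀ h G x y) D G ∧
      ∀ w, D w = densityDeriv g₀ h G w x y := by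
  let pη : Param d q →L[ℝ] EuclideanSpace ℝ (Fin q) :=
    (ContinuousLinearMap.fst ℝ _ _).comp ((ContinuousLinearMap.snd ℝ _ _).comp
      (ContinuousLinearMap.snd ℝ _ _))
  let pν : Param d q →L[ℝ] ℝ :=
    (ContinuousLinearMap.snd ℝ _ _).comp ((ContinuousLinearMap.snd ℝ _ _).comp
      (ContinuousLinearMap.snd ℝ _ _))
  let Z : Param d q →L[ℝ] ℝ := (innerSL ℝ x).comp (ContinuousLinearMap.fst ℝ _ _)
    + (ContinuousLinearMap.fst ℝ _ _).comp (ContinuousLinearMap.snd ℝ _ _)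
  have hZ : ∀ w : Param d q, Z w = inner ℝ w.β x + w.τ := fun w => by
    rw [real_inner_comm]; rfl
  obtain ⟨D, hD, hDab⟩ := hasStrictFDerivAt_promptDensity (m := h x G.η) hG y
  have h1 : HasStrictFDerivAt (fun G : Param d q => h x G.η) ((fderiv ℝ (h x) G.η).comp pη) G :=
    (hx.contDiffAt.hasStrictFDerivAt one_ne_zero).comp G (pη.hasStrictFDerivAt)
  have h2 : HasStrictFDerivAt (fun G : Param d q => promptDensity (h x G.η) G.ν y)
      (D.comp (((fderiv ℝ (h x) G.η).comp pη).prod pν)) G :=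
    HasStrictFDerivAt.comp (g := fun p : ℝ × ℝ => promptDensity p.1 p.2 y) G hD
      (h1.prodMk pν.hasStrictFDerivAt)
  have h3 : HasStrictDerivAt (fun z : ℝ => Real.exp z / (1 + Real.exp z))
      (Real.exp (Z G) / (1 + Real.exp (Z G)) ^ 2) (Z G) := by
    have := (Real.hasStrictDerivAt_exp (Z G)).fun_div
      ((Real.hasStrictDerivAt_exp (Z G)).const_add 1) (by positivity)
    have e : Real.exp (Z G) / (1 + Real.exp (Z G)) ^ 2 = (Real.exp (Z G) * (1 + Real.exp (Z G))
        - Real.exp (Z G) * Real.exp (Z G)) / (1 + Real.exp (Z G)) ^ 2 := by ring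
    rw [e]
    exact this
  have h4 := h3.comp_hasStrictFDerivAt G Z.hasStrictFDerivAt
  have h5 := (h4.mul (h2.sub_const (g₀ x y))).const_add (g₀ x y)
  refine ⟨_, h5.congr_of_eventuallyEq (Eventually.of_forall fun G' => ?_), fun w => ?_⟩
  · show _ = modelDensity g₀ h G' x y
    rw [modelDensity_eq, ← hZ G']
    rfl
  · have e1 : D (fderiv ℝ (h x) G.η (pη w), pν w)
        = fderiv ℝ (h x) G.η w.η * deriv (fun m => promptDensity m G.ν y) (h x G.η)
        + w.ν * deriv (fun v => promptDensity (h x G.η) v y) G.ν := hDab _ _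
    simp only [densityDeriv, ← hZ, ← e1]
    simp
    ring

theorem tendsto_inv_mul_sub_of_hasStrictFDerivAt {E : Type*} [NormedAddCommGroup E]
    [NormedSpace ℝ E] {f : E → ℝ} {D : E →L[ℝ] ℝ} {a w : E} (hf : HasStrictFDerivAt f D a)
    {u v : ℕ → E} (hu : Tendsto u atTop (𝓝 a)) (hv : Tendsto v atTop (𝓝 a))
    (hw : Tendsto (fun n => ‖u n - v n‖⁻¹ • (u n - v n)) atTop (𝓝 w)) :
    Tendsto (fun n => ‖u n - v n‖⁻¹ * (f (u n) - f (v n))) atTop (𝓝 (D w)) := by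
  have h1 : Tendsto (fun n => (u n, v n)) atTop (𝓝 (a, a)) := hu.prodMk_nhds hv
  have h2 := (hf.isLittleO.comp_tendsto h1).norm_right.tendsto_div_nhds_zero
  have h3 := h2.add ((D.continuous.tendsto w).comp hw)
  rw [zero_add] at h3
  refine h3.congr fun n => ?_
  simp only [Function.comp_apply, map_smul, smul_eq_mul]
  ring

/-- Fatou's lemma for an almost everywhere limit of functions that converge to zero in `L¹`. -/
theorem ae_eq_zero_of_tendsto_of_tendsto_integral {Z : Type*} [MeasurableSpace Z] {ρ : Measure Z}
    {F : ℕ → Z → ℝ} {f : Z → ℝ} (hF : ∀ n, Measurable (F n)) (hFi : ∀ n, Integrable (F n) ρ)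
    (h0 : Tendsto (fun n => ∫ z, |F n z| ∂ρ) atTop (𝓝 0))
    (hlim : ∀ᵐ z ∂ρ, Tendsto (fun n => F n z) atTop (𝓝 (f z))) : ∀ᵐ z ∂ρ, f z = 0 := by
  have hm : ∀ n, Measurable fun z => ENNReal.ofReal |F n z| := fun n => by
    have := hF n
    fun_prop
  have h1 : ∫⁻ z, liminf (fun n => ENNReal.ofReal |F n z|) atTop ∂ρ = 0 := by
    refine le_antisymm ((lintegral_liminf_le hm).trans ?_) bot_le
    have : Tendsto (fun n => ∫⁻ z, ENNReal.ofReal |F n z| ∂ρ) atTop (𝓝 0) := by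
      simp_rw [fun n => (ofReal_integral_eq_lintegral_ofReal (hFi n).abs
        (ae_of_all _ fun z => abs_nonneg (F n z))).symm]
      simpa using ENNReal.tendsto_ofReal h0
    exact this.liminf_eq.le
  rw [lintegral_eq_zero_iff (Measurable.liminf hm)] at h1
  filter_upwards [h1, hlim] with z hz hz'
  have h2 : Tendsto (fun n => ENNReal.ofReal |F n z|) atTop (𝓝 (ENNReal.ofReal |f z|)) :=
    ENNReal.tendsto_ofReal hz'.abs
  rw [h2.liminf_eq] at hz
  simpa using hz

/-- Proper affine subspaces are Lebesgue null sets, so an absolutely continuous law charges none of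
them. -/
theorem eq_zero_of_ae_inner_add_eq_zero [IsProbabilityMeasure μ] (hμ : μ ≪ volume)
    {β : EuclideanSpace ℝ (Fin d)} {τ : ℝ} (h0 : ∀ᵐ x ∂μ, inner ℝ β x + τ = 0) :
    β = 0 ∧ τ = 0 := by
  have hβ : β = 0 := by
    by_contra hβ
    let s : AffineSubspace ℝ (EuclideanSpace ℝ (Fin d)) :=
      { carrier := {x | inner ℝ β x + τ = 0}
        smul_vsub_vadd_mem' := fun c p₁ p₂ p₃ h₁ h₂ h₃ => by
          simp only [Set.mem_ofPred_eq, vsub_eq_sub, vadd_eq_add, inner_add_right,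
            inner_smul_right, inner_sub_right] at *
          have : inner ℝ β p₁ = inner ℝ β p₂ := by linarith
          rw [this]
          linarith }
    have hs : s ≠ ⊤ := fun hs => by
      have h1 : ∀ x, inner ℝ β x + τ = 0 := fun x => by
        have : x ∈ s := hs ▸ AffineSubspace.mem_top ℝ _ x
        exact this
      have h2 := h1 0
      have h3 := h1 β
      rw [inner_zero_right, zero_add] at h2
      rw [h2, add_zero] at h3
      exact hβ (inner_self_eq_zero.1 h3)
    have h1 : ∀ᵐ x ∂μ, x ∉ (s : Set (EuclideanSpace ℝ (Fin d))) :=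
      hμ.ae_le (measure_eq_zero_iff_ae_notMem.1 (Measure.addHaar_affineSubspace volume s hs))
    obtain ⟨x, hx, hx'⟩ := (h1.and h0).exists
    exact hx hx'
  subst hβ
  obtain ⟨x, hx⟩ := h0.exists
  exact ⟨rfl, by simpa using hx⟩

/-- The expert is differentiable in `η` only for almost every `x`, hence its derivative is only an
almost everywhere limit of measurable difference quotients. -/
theorem aemeasurable_fderiv_apply (hh_meas : ∀ η, Measurable fun x => h x η)
    (hh_diff : ∀ᵐ x ∂μ, ContDiff ℝ 1 (h x)) (η v : EuclideanSpace ℝ (Fin q)) :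
    AEMeasurable (fun x => fderiv ℝ (h x) η v) μ := by
  refine aemeasurable_of_tendsto_metrizable_ae atTop
    (f := fun (n : ℕ) x => (n : ℝ) • (h x (η + (n : ℝ)⁻¹ • v) - h x η))
    (fun n => (((hh_meas _).sub (hh_meas _)).const_smul (n : ℝ)).aemeasurable) ?_
  filter_upwards [hh_diff] with x hx
  refine ((hx.differentiable one_ne_zero).differentiableAt (x := η)).hasFDerivAt.lim v ?_
  simpa using tendsto_natCast_atTop_atTop (R := ℝ)

end

/-! ### Identifiability and the lower bound by the loss -/

section

variable {d q : ℕ} {μ : Measure (EuclideanSpace ℝ (Fin d))}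
  {g₀ : EuclideanSpace ℝ (Fin d) → ℝ → ℝ}
  {h : EuclideanSpace ℝ (Fin d) → EuclideanSpace ℝ (Fin q) → ℝ}
  {Θ : Set (EuclideanSpace ℝ (Fin q) × ℝ)} {G G' : Param d q}

theorem param_ext (hβ : G.β = G'.β) (hτ : G.τ = G'.τ) (hη : G.η = G'.η) (hν : G.ν = G'.ν) :
    G = G' :=
  Prod.ext hβ (Prod.ext hτ (Prod.ext hη hν))

theorem eq_of_one_div_one_add_exp_eq {a b : ℝ}
    (hab : 1 / (1 + Real.exp a) - 1 / (1 + Real.exp b) = 0) : a = b := by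
  have h1 := sub_eq_zero.1 hab
  rw [div_eq_div_iff (by positivity) (by positivity)] at h1
  exact Real.exp_injective (by linarith)

/-- Identifiability of the model. When the two parameters have the same `(η, ν)`, distinguishability
is applied with another point of `Θ` and the coefficient `b₁ = 0`. -/
theorem eq_of_ae_modelDensity_eq [IsProbabilityMeasure μ] (hμ : μ ≪ volume)
    (hΘ : Θ.Nontrivial) (hdist : Distinguishable μ g₀ h Θ) (hG : (G.η, G.ν) ∈ Θ)
    (hG' : (G'.η, G'.ν) ∈ Θ)
    (heq : ∀ᵐ z ∂(μ.prod (volume : Measure ℝ)),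
      modelDensity g₀ h G z.1 z.2 - modelDensity g₀ h G' z.1 z.2 = 0) : G = G' := by
  by_cases hθ : (G'.η, G'.ν) = (G.η, G.ν)
  · obtain ⟨hη, hν⟩ := Prod.mk.inj hθ
    obtain ⟨θ₁, hθ₁, hne⟩ := hΘ.exists_ne (G.η, G.ν)
    have h1 := hdist θ₁ hθ₁ _ hG hne
      (fun x => 1 / (1 + Real.exp (inner ℝ G.β x + G.τ))
        - 1 / (1 + Real.exp (inner ℝ G'.β x + G'.τ))) 0
      (fun x => Real.exp (inner ℝ G.β x + G.τ) / (1 + Real.exp (inner ℝ G.β x + G.τ))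
        - Real.exp (inner ℝ G'.β x + G'.τ) / (1 + Real.exp (inner ℝ G'.β x + G'.τ))) 0 0
      (by fun_prop) measurable_const (by fun_prop) measurable_const measurable_const (by
        filter_upwards [heq] with z hz
        simp only [modelDensity, hη, hν] at hz
        simp only [Pi.zero_apply, zero_mul, add_zero]
        linarith)
    have h2 : ∀ᵐ x ∂μ, inner ℝ (G.β - G'.β) x + (G.τ - G'.τ) = 0 := by
      filter_upwards [h1] with x hx
      have := eq_of_one_div_one_add_exp_eq hx.1
      rw [inner_sub_left]
      linarith
    obtain ⟨h3, h4⟩ := eq_zero_of_ae_inner_add_eq_zero hμ h2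
    exact param_ext (sub_eq_zero.1 h3) (sub_eq_zero.1 h4) hη.symm hν.symm
  · exfalso
    have h1 := hdist _ hG' _ hG hθ
      (fun x => 1 / (1 + Real.exp (inner ℝ G.β x + G.τ))
        - 1 / (1 + Real.exp (inner ℝ G'.β x + G'.τ)))
      (fun x => -(Real.exp (inner ℝ G'.β x + G'.τ) / (1 + Real.exp (inner ℝ G'.β x + G'.τ))))
      (fun x => Real.exp (inner ℝ G.β x + G.τ) / (1 + Real.exp (inner ℝ G.β x + G.τ))) 0 0
      (by fun_prop) (by fun_prop) (by fun_prop) measurable_const measurable_const (by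
        filter_upwards [heq] with z hz
        simp only [modelDensity] at hz
        simp only [Pi.zero_apply, zero_mul, add_zero]
        linarith)
    obtain ⟨x, hx⟩ := h1.exists
    have h2 : 0 < Real.exp (inner ℝ G.β x + G.τ) / (1 + Real.exp (inner ℝ G.β x + G.τ)) := by
      positivity
    exact h2.ne' hx.2.2.1

/-- Identifiability to first order: the derivative of the model density degenerates in no
direction. -/
theorem eq_zero_of_ae_densityDeriv_eq_zero [IsProbabilityMeasure μ] (hμ : μ ≪ volume)
    (hh_meas : ∀ η, Measurable fun x => h x η) (hh_diff : ∀ᵐ x ∂μ, ContDiff ℝ 1 (h x))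
    (hΘ : Θ.Nontrivial) (hdist : Distinguishable μ g₀ h Θ)
    (hjac : ∀ η a : EuclideanSpace ℝ (Fin q), a ≠ 0 → ¬ ∀ᵐ x ∂μ, fderiv ℝ (h x) η a = 0)
    (hG : (G.η, G.ν) ∈ Θ) {w : Param d q}
    (heq : ∀ᵐ z ∂(μ.prod (volume : Measure ℝ)), densityDeriv g₀ h G w z.1 z.2 = 0) : w = 0 := by
  obtain ⟨θ₁, hθ₁, hne⟩ := hΘ.exists_ne (G.η, G.ν)
  have hJ := aemeasurable_fderiv_apply hh_meas hh_diff G.η w.η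
  let J : EuclideanSpace ℝ (Fin d) → ℝ := hJ.mk _
  have hJm : Measurable J := hJ.measurable_mk
  have hJeq : ∀ᵐ x ∂μ, fderiv ℝ (h x) G.η w.η = J x := hJ.ae_eq_mk
  have h1 := hdist θ₁ hθ₁ _ hG hne
    (fun x => -(Real.exp (inner ℝ G.β x + G.τ) / (1 + Real.exp (inner ℝ G.β x + G.τ)) ^ 2
      * (inner ℝ w.β x + w.τ))) 0
    (fun x => Real.exp (inner ℝ G.β x + G.τ) / (1 + Real.exp (inner ℝ G.β x + G.τ)) ^ 2
      * (inner ℝ w.β x + w.τ))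
    (fun x => Real.exp (inner ℝ G.β x + G.τ) / (1 + Real.exp (inner ℝ G.β x + G.τ)) * J x)
    (fun x => Real.exp (inner ℝ G.β x + G.τ) / (1 + Real.exp (inner ℝ G.β x + G.τ)) * w.ν)
    (by fun_prop) measurable_const (by fun_prop) (by fun_prop) (by fun_prop) (by
      filter_upwards [heq, Measure.quasiMeasurePreserving_fst.ae hJeq] with z hz hzJ
      simp only [densityDeriv, hzJ] at hz
      simp only [Pi.zero_apply, zero_mul, add_zero]
      linarith)
  have h2 : ∀ᵐ x ∂μ, inner ℝ w.β x + w.τ = 0 := by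
    filter_upwards [h1] with x hx
    exact (mul_eq_zero.1 hx.2.2.1).resolve_left (by positivity)
  have h3 : ∀ᵐ x ∂μ, fderiv ℝ (h x) G.η w.η = 0 := by
    filter_upwards [h1, hJeq] with x hx hxJ
    rw [hxJ]
    exact (mul_eq_zero.1 hx.2.2.2.1).resolve_left (by positivity)
  have hν : w.ν = 0 := by
    obtain ⟨x, hx⟩ := h1.exists
    exact (mul_eq_zero.1 hx.2.2.2.2).resolve_left (by positivity)
  have hη : w.η = 0 := by
    by_contra hne
    exact hjac _ _ hne h3
  obtain ⟨hβ, hτ⟩ := eq_zero_of_ae_inner_add_eq_zero hμ h2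
  exact param_ext hβ hτ hη hν

/-- The `L¹` distance of two model densities dominates the distance of their parameters. -/
theorem exists_mul_norm_sub_le_integral_abs [IsProbabilityMeasure μ] (hμ : μ ≪ volume)
    (hg : IsConditionalDensity g₀)
    (hh_meas : ∀ η, Measurable fun x => h x η) (hh_diff : ∀ᵐ x ∂μ, ContDiff ℝ 1 (h x))
    (hΘ_pos : ∀ θ ∈ Θ, 0 < θ.2) (hΘ : Θ.Nontrivial) {Ξ : Set (Param d q)} (hΞ : IsCompact Ξ)
    (hΞΘ : ∀ G ∈ Ξ, (G.η, G.ν) ∈ Θ) (hdist : Distinguishable μ g₀ h Θ)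
    (hjac : ∀ η a : EuclideanSpace ℝ (Fin q), a ≠ 0 → ¬ ∀ᵐ x ∂μ, fderiv ℝ (h x) η a = 0) :
    ∃ c : ℝ, 0 < c ∧ ∀ G ∈ Ξ, ∀ G' ∈ Ξ, c * ‖G - G'‖ ≤
      ∫ z, |modelDensity g₀ h G z.1 z.2 - modelDensity g₀ h G' z.1 z.2|
        ∂(μ.prod (volume : Measure ℝ)) := by
  set ρ := μ.prod (volume : Measure ℝ)
  have hν : ∀ G ∈ Ξ, 0 < G.ν := fun G hG => hΘ_pos _ (hΞΘ G hG)
  have hden : ∀ G ∈ Ξ, IsConditionalDensity (modelDensity g₀ h G) := fun G hG =>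
    isConditionalDensity_modelDensity hg (hh_meas _) (hν G hG)
  by_contra! hcon
  choose! u hu v hv huv using fun n : ℕ => hcon (1 / ((n : ℝ) + 1)) (by positivity)
  have hV0 : ∀ n, 0 ≤ ∫ z, |modelDensity g₀ h (u n) z.1 z.2 - modelDensity g₀ h (v n) z.1 z.2| ∂ρ :=
    fun n => integral_nonneg fun z => abs_nonneg _
  have ht : ∀ n, 0 < ‖u n - v n‖ := fun n =>
    (mul_pos_iff_of_pos_left (by positivity)).1 ((hV0 n).trans_lt (huv n))
  -- the directions of the differences, on the unit sphere
  let e : ℕ → Param d q := fun n => ‖u n - v n‖⁻¹ • (u n - v n)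
  have he : ∀ n, e n ∈ Metric.sphere (0 : Param d q) 1 := fun n => by
    rw [mem_sphere_zero_iff_norm, norm_smul, norm_inv, norm_norm, inv_mul_cancel₀ (ht n).ne']
  obtain ⟨⟨a, b, w⟩, ⟨ha, hb, hw⟩, φ, hφ, hlim⟩ :=
    (hΞ.prod (hΞ.prod (isCompact_sphere (0 : Param d q) 1))).tendsto_subseq
      (x := fun n => (u n, v n, e n)) fun n => ⟨hu n, hv n, he n⟩
  have hua : Tendsto (fun n => u (φ n)) atTop (𝓝 a) := (continuous_fst.tendsto _).comp hlim
  have hvb : Tendsto (fun n => v (φ n)) atTop (𝓝 b) :=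
    ((continuous_fst.comp continuous_snd).tendsto _).comp hlim
  have hew : Tendsto (fun n => e (φ n)) atTop (𝓝 w) :=
    ((continuous_snd.comp continuous_snd).tendsto _).comp hlim
  let F : ℕ → EuclideanSpace ℝ (Fin d) × ℝ → ℝ := fun n z => ‖u (φ n) - v (φ n)‖⁻¹ *
    (modelDensity g₀ h (u (φ n)) z.1 z.2 - modelDensity g₀ h (v (φ n)) z.1 z.2)
  have hFm : ∀ n, Measurable (F n) := fun n =>
    ((hden _ (hu _)).measurable.sub (hden _ (hv _)).measurable).const_mul _
  have hFi : ∀ n, Integrable (F n) ρ := fun n =>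
    ((hden _ (hu _)).integrable_prod.sub (hden _ (hv _)).integrable_prod).const_mul _
  have hF0 : Tendsto (fun n => ∫ z, |F n z| ∂ρ) atTop (𝓝 0) := by
    refine squeeze_zero (fun n => integral_nonneg fun z => abs_nonneg _) (fun n => ?_)
      (tendsto_one_div_add_atTop_nhds_zero_nat.comp hφ.tendsto_atTop)
    simp only [F, abs_mul, abs_inv, abs_norm]
    rw [integral_const_mul, inv_mul_le_iff₀ (ht _), mul_comm]
    exact (huv _).le
  have hdiff : ∀ᵐ z ∂ρ, ContDiff ℝ 1 (h z.1) := Measure.quasiMeasurePreserving_fst.ae hh_diff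
  by_cases hab : a = b
  · subst hab
    have h1 : ∀ᵐ z ∂ρ, densityDeriv g₀ h a w z.1 z.2 = 0 := by
      refine ae_eq_zero_of_tendsto_of_tendsto_integral hFm hFi hF0 ?_
      filter_upwards [hdiff] with z hz
      obtain ⟨D, hD, hDw⟩ := hasStrictFDerivAt_modelDensity (g₀ := g₀) (hν a ha) hz z.2
      rw [← hDw]
      exact tendsto_inv_mul_sub_of_hasStrictFDerivAt hD hua hvb hew
    have h2 := eq_zero_of_ae_densityDeriv_eq_zero hμ hh_meas hh_diff hΘ hdist hjac (hΞΘ a ha) h1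
    rw [mem_sphere_zero_iff_norm, h2, norm_zero] at hw
    exact zero_ne_one hw
  · have h1 : ∀ᵐ z ∂ρ, ‖a - b‖⁻¹ *
        (modelDensity g₀ h a z.1 z.2 - modelDensity g₀ h b z.1 z.2) = 0 := by
      refine ae_eq_zero_of_tendsto_of_tendsto_integral hFm hFi hF0 ?_
      filter_upwards [hdiff] with z hz
      obtain ⟨D, hD, -⟩ := hasStrictFDerivAt_modelDensity (g₀ := g₀) (hν a ha) hz z.2
      obtain ⟨D', hD', -⟩ := hasStrictFDerivAt_modelDensity (g₀ := g₀) (hν b hb) hz z.2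
      exact ((hua.sub hvb).norm.inv₀ (norm_ne_zero_iff.2 (sub_ne_zero.2 hab))).mul
        ((hD.continuousAt.tendsto.comp hua).sub (hD'.continuousAt.tendsto.comp hvb))
    refine hab (eq_of_ae_modelDensity_eq hμ hΘ hdist (hΞΘ a ha) (hΞΘ b hb) ?_)
    filter_upwards [h1] with z hz
    exact (mul_eq_zero.1 hz).resolve_left (inv_ne_zero (norm_ne_zero_iff.2 (sub_ne_zero.2 hab)))

theorem promptDist_le (G G' : Param d q) : promptDist G G' ≤ 2 * ‖G - G'‖ := by
  refine Real.sqrt_le_iff.2 ⟨by positivity, ?_⟩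
  have h1 := pow_le_pow_left₀ (norm_nonneg _) (norm_β_sub_le G G') 2
  have h2 := pow_le_pow_left₀ (norm_nonneg _) (norm_η_sub_le G G') 2
  have h3 := pow_le_pow_left₀ (abs_nonneg _) (abs_ν_sub_le G G') 2
  rw [sq_abs] at h3
  nlinarith [sq_nonneg ‖G - G'‖]

theorem abs_exp_sub_exp_le {a b T : ℝ} (ha : a ≤ T) (hb : b ≤ T) :
    |Real.exp a - Real.exp b| ≤ Real.exp T * |a - b| := by
  have key : ∀ a b : ℝ, a ≤ T → Real.exp a - Real.exp b ≤ Real.exp T * |a - b| := fun a b ha => by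
    have h1 : Real.exp a - Real.exp b ≤ Real.exp a * (a - b) := by
      have h2 : Real.exp b = Real.exp a * Real.exp (b - a) := by rw [← Real.exp_add]; ring_nf
      have h3 := Real.add_one_le_exp (b - a)
      nlinarith [Real.exp_pos a]
    calc _ ≤ _ := h1
      _ ≤ Real.exp a * |a - b| := by gcongr; exact le_abs_self _
      _ ≤ _ := by gcongr
  refine abs_le.2 ⟨?_, key a b ha⟩
  have := key b a hb
  rw [abs_sub_comm] at this
  linarith

theorem exists_lossD₁_le_mul_norm_sub {Ξ : Set (Param d q)} (hΞ : IsCompact Ξ) :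
    ∃ K : ℝ, 0 < K ∧ ∀ G ∈ Ξ, ∀ G' ∈ Ξ, lossD₁ G G' ≤ K * ‖G - G'‖ := by
  obtain ⟨T, hT⟩ := hΞ.isBounded.exists_norm_le
  have hτ : ∀ G ∈ Ξ, G.τ ≤ T := fun G hG =>
    (le_abs_self _).trans (((norm_fst_le G.2).trans (norm_snd_le G)).trans (hT G hG))
  refine ⟨5 * Real.exp T, by positivity, fun G hG G' hG' => ?_⟩
  have h1 := abs_exp_sub_exp_le (hτ G hG) (hτ G' hG')
  have h2 := abs_τ_sub_le G G'
  have h3 := promptDist_le G G'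
  have h4 := Real.exp_le_exp.2 (hτ G hG)
  have h5 := Real.exp_le_exp.2 (hτ G' hG')
  calc lossD₁ G G' ≤ Real.exp T * ‖G - G'‖ + (Real.exp T + Real.exp T) * (2 * ‖G - G'‖) :=
        add_le_add (h1.trans (by gcongr))
          (mul_le_mul (by linarith) h3 (Real.sqrt_nonneg _) (by positivity))
    _ = _ := by ring

end

end ContaminatedMoE

end

theorem mainTheorem1 {d q q₀ : ℕ}
    -- the law of the covariates, carried by a bounded set
    (μ : MeasureTheory.Measure (EuclideanSpace ℝ (Fin d)))
    [MeasureTheory.IsProbabilityMeasure μ]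
    (hμ_ac : μ ≪ MeasureTheory.volume)
    (X : Set (EuclideanSpace ℝ (Fin d))) (hX : Bornology.IsBounded X)
    (hμX : ∀ᵐ x ∂μ, x ∈ X)
    -- the pre-trained model
    (f₀ : ℝ → ℝ → ℝ → ℝ)
    (h₀ : EuclideanSpace ℝ (Fin d) → EuclideanSpace ℝ (Fin q₀) → ℝ)
    (η₀ : EuclideanSpace ℝ (Fin q₀)) (ν₀ : ℝ)
    (hf₀ : ContaminatedMoE.IsConditionalDensity (ContaminatedMoE.pretrained f₀ h₀ η₀ ν₀))
    -- the prompt expert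
    (h : EuclideanSpace ℝ (Fin d) → EuclideanSpace ℝ (Fin q) → ℝ)
    (hh_meas : ∀ η, Measurable fun x => h x η)
    (hh_diff : ∀ᵐ x ∂μ, ContDiff ℝ 1 (h x))
    (hh_dom : ∀ R : ℝ, ∃ L : EuclideanSpace ℝ (Fin d) → ℝ, MeasureTheory.Integrable L μ ∧
      ∀ᵐ x ∂μ, ∀ η : EuclideanSpace ℝ (Fin q), ‖η‖ ≤ R → ‖fderiv ℝ (h x) η‖ ≤ L x)
    -- the parameter space, and the set of values of `(η, ν)`
    (Θ : Set (EuclideanSpace ℝ (Fin q) × ℝ)) (hΘ_pos : ∀ θ ∈ Θ, 0 < θ.2)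
    (hΘ_two : Θ.Nontrivial)
    (Ξ : Set (ContaminatedMoE.Param d q)) (hΞ_compact : IsCompact Ξ)
    (hΞΘ : ∀ G ∈ Ξ, (G.η, G.ν) ∈ Θ)
    -- distinguishability
    (hdist : ContaminatedMoE.Distinguishable μ (ContaminatedMoE.pretrained f₀ h₀ η₀ ν₀) h Θ)
    -- the Jacobian of the prompt expert does not vanish in any direction
    (hjac : ∀ η a : EuclideanSpace ℝ (Fin q), a ≠ 0 →
      ¬ ∀ᵐ x ∂μ, fderiv ℝ (h x) η a = 0) :
    (∃ C₁ : ℝ, 0 < C₁ ∧ ∀ G ∈ Ξ, ∀ G' ∈ Ξ,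
      C₁ * ContaminatedMoE.lossD₁ G G' ≤
        ∫ x, ContaminatedMoE.hellinger
          (ContaminatedMoE.modelDensity (ContaminatedMoE.pretrained f₀ h₀ η₀ ν₀) h G x)
          (ContaminatedMoE.modelDensity (ContaminatedMoE.pretrained f₀ h₀ η₀ ν₀) h G' x) ∂μ) ∧
    ∃ C : ℝ, 0 < C ∧ ∀ n : ℕ, 2 ≤ n → ∀ G' ∈ Ξ,
      ∀ Ghat : (Fin n → EuclideanSpace ℝ (Fin d) × ℝ) → ContaminatedMoE.Param d q,
        Measurable Ghat →
        (∀ᵐ s ∂(ContaminatedMoE.sampleLaw μ (ContaminatedMoE.pretrained f₀ h₀ η₀ ν₀) h G' n),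
          ContaminatedMoE.IsMLE (ContaminatedMoE.pretrained f₀ h₀ η₀ ν₀) h Ξ s (Ghat s)) →
        (∫⁻ s, ENNReal.ofReal (|Real.exp (Ghat s).τ - Real.exp G'.τ| ^ 2)
            ∂(ContaminatedMoE.sampleLaw μ (ContaminatedMoE.pretrained f₀ h₀ η₀ ν₀) h G' n)
          ≤ ENNReal.ofReal (C * (Real.log n / n))) ∧
        (∫⁻ s, ENNReal.ofReal
              (Real.exp G'.τ ^ 2 * ContaminatedMoE.promptDist (Ghat s) G' ^ 2)
            ∂(ContaminatedMoE.sampleLaw μ (ContaminatedMoE.pretrained f₀ h₀ η₀ ν₀) h G' n)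
          ≤ ENNReal.ofReal (C * (Real.log n / n))) := by

  have hν : ∀ G ∈ Ξ, 0 < G.ν := fun G hG => hΘ_pos _ (hΞΘ G hG)
  have hden : ∀ G ∈ Ξ, ContaminatedMoE.IsConditionalDensity
      (ContaminatedMoE.modelDensity (ContaminatedMoE.pretrained f₀ h₀ η₀ ν₀) h G) := fun G hG =>
    ContaminatedMoE.isConditionalDensity_modelDensity hf₀ (hh_meas _) (hν G hG)
  obtain ⟨c, hc, hcle⟩ := ContaminatedMoE.exists_mul_norm_sub_le_integral_abs hμ_ac hf₀ hh_meas
    hh_diff hΘ_pos hΘ_two hΞ_compact hΞΘ hdist hjac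
  obtain ⟨K, hK, hKle⟩ := ContaminatedMoE.exists_lossD₁_le_mul_norm_sub hΞ_compact
  obtain ⟨C, hC, hrisk⟩ := ContaminatedMoE.exists_hellinger_risk_bound hX hμX hf₀ hh_meas
    hh_diff hh_dom hΞ_compact hν
  have hlow : ∀ G ∈ Ξ, ∀ G' ∈ Ξ, c / (3 * K) * ContaminatedMoE.lossD₁ G G' ≤
      ∫ x, ContaminatedMoE.hellinger
        (ContaminatedMoE.modelDensity (ContaminatedMoE.pretrained f₀ h₀ η₀ ν₀) h G x)
        (ContaminatedMoE.modelDensity (ContaminatedMoE.pretrained f₀ h₀ η₀ ν₀) h G' x) ∂μ := by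
    intro G hG G' hG'
    have h1 := (hcle G hG G' hG').trans
      (ContaminatedMoE.integral_abs_sub_le_hellinger (hden G hG) (hden G' hG'))
    calc c / (3 * K) * ContaminatedMoE.lossD₁ G G' ≤ c / (3 * K) * (K * ‖G - G'‖) := by
          gcongr
          exact hKle G hG G' hG'
      _ = c * ‖G - G'‖ / 3 := by field_simp
      _ ≤ _ := by linarith
  set C₁ := c / (3 * K) with hC₁
  have hC₁0 : 0 < C₁ := by positivity
  refine ⟨⟨C₁, hC₁0, hlow⟩, C / C₁ ^ 2, by positivity, fun n hn G' hG' Ghat _ hMLE => ?_⟩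
  -- both losses are squares of quantities below the loss `D₁`, which `hlow` bounds by the mean
  -- Hellinger distance
  have key : ∀ f : (Fin n → EuclideanSpace ℝ (Fin d) × ℝ) → ℝ, (∀ s, 0 ≤ f s) →
      (∀ s, f s ≤ ContaminatedMoE.lossD₁ (Ghat s) G') →
      ∫⁻ s, ENNReal.ofReal (f s ^ 2)
          ∂(ContaminatedMoE.sampleLaw μ (ContaminatedMoE.pretrained f₀ h₀ η₀ ν₀) h G' n)
        ≤ ENNReal.ofReal (C / C₁ ^ 2 * (Real.log n / n)) := by
    intro f hf0 hf
    calc _ ≤ ∫⁻ s, ENNReal.ofReal ((C₁ ^ 2)⁻¹) * ENNReal.ofReal ((∫ x, ContaminatedMoE.hellinger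
          (ContaminatedMoE.modelDensity (ContaminatedMoE.pretrained f₀ h₀ η₀ ν₀) h (Ghat s) x)
          (ContaminatedMoE.modelDensity (ContaminatedMoE.pretrained f₀ h₀ η₀ ν₀) h G' x) ∂μ) ^ 2)
          ∂(ContaminatedMoE.sampleLaw μ (ContaminatedMoE.pretrained f₀ h₀ η₀ ν₀) h G' n) := by
          refine MeasureTheory.lintegral_mono_ae ?_
          filter_upwards [hMLE] with s hs
          rw [← ENNReal.ofReal_mul (by positivity)]
          refine ENNReal.ofReal_le_ofReal ?_
          rw [← div_eq_inv_mul, le_div_iff₀ (by positivity), ← mul_pow, mul_comm]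
          have h1 := mul_le_mul_of_nonneg_left (hf s) hC₁0.le
          exact pow_le_pow_left₀ (mul_nonneg hC₁0.le (hf0 s)) (h1.trans (hlow _ hs.1 _ hG')) 2
      _ = ENNReal.ofReal ((C₁ ^ 2)⁻¹) * _ :=
          MeasureTheory.lintegral_const_mul' _ _ ENNReal.ofReal_ne_top
      _ ≤ ENNReal.ofReal ((C₁ ^ 2)⁻¹) * ENNReal.ofReal (C * (Real.log n / n)) := by
          gcongr
          exact hrisk n hn G' hG' Ghat hMLE
      _ = _ := by
          rw [← ENNReal.ofReal_mul (by positivity)]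
          congr 1
          ring
  have hdist0 : ∀ s, 0 ≤ ContaminatedMoE.promptDist (Ghat s) G' := fun s => Real.sqrt_nonneg _
  refine ⟨key _ (fun s => abs_nonneg _) fun s => ?_, ?_⟩
  · have := hdist0 s
    exact le_add_of_nonneg_right (by positivity)
  · have h2 := key (fun s => Real.exp G'.τ * ContaminatedMoE.promptDist (Ghat s) G')
      (fun s => mul_nonneg (Real.exp_pos _).le (hdist0 s)) fun s => by
        have h1 := hdist0 s
        refine le_add_of_nonneg_of_le (abs_nonneg _) ?_
        gcongr
        exact le_add_of_nonneg_left (Real.exp_pos _).le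
    simpa only [mul_pow] using h2
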